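/- Let $N\ge 1$, let $k$ be a field of characteristic $0$ (e.g. $\mathbb C$), let $\boldsymbol t=(t_{\alpha j})_{1\le\alpha\le N,\,j\ge1}$, and let $\boldsymbol e_1,\dots,\boldsymbol e_N$ be the standard basis of $\mathbb Z^N$. Put $\xi(\boldsymbol t_\gamma,z)=\sum_{j\ge1}t_{\gamma j}z^j$, let $\boldsymbol t\pm[z^{-1}]_\gamma$ be obtained from $\boldsymbol t$ by replacing $t_{\gamma j}$ with $t_{\gamma j}\pm z^{-j}/j$ for all $j$, and for $\boldsymbol s\in\mathbb Z^N$ with $\sum_\alpha s_\alpha=0$ put $\epsilon_{\alpha\gamma}(\boldsymbol s)=(-1)^{s_{\alpha+1}+\dots+s_\gamma}$ if $\alpha<\gamma$, $1$ if $\alpha=\gamma$, and $-(-1)^{s_{\gamma+1}+\dots+s_\alpha}$ if $\alpha>\gamma$. Let $\tau(\boldsymbol s,\boldsymbol t)\in k[[\boldsymbol t]]$, $\boldsymbol s\in\mathbb Z^N$, $\sum_\alpha s_\alpha=0$, be a tau function of the $N$-component KP hierarchy, that is, for all $\alpha,\beta,\boldsymbol s,\boldsymbol s'$, identically in $\boldsymbol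 t,\boldsymbol t'$, $$\sum_{\gamma=1}^N\epsilon_{\alpha\gamma}(\boldsymbol s)\epsilon_{\beta\gamma}(\boldsymbol s')\,\operatorname{Res}_z\, z^{s_\gamma-s'_\gamma+\delta_{\alpha\gamma}+\delta_{\beta\gamma}-2}e^{\xi(\boldsymbol t_\gamma-\boldsymbol t'_\gamma,z)}\tau(\boldsymbol s+\boldsymbol e_\alpha-\boldsymbol e_\gamma,\boldsymbol t-[z^{-1}]_\gamma)\,\tau(\boldsymbol s'-\boldsymbol e_\beta+\boldsymbol e_\gamma,\boldsymbol t'+[z^{-1}]_\gamma)=0,$$ where $\operatorname{Res}_z$ is the coefficient of $z^{-1}$. Fix $\boldsymbol s$ with $\tau(\boldsymbol s,\cdot)\ne0$. Let $\Psi$ be the $N\times N$ wave function with entries $$\Psi_{\alpha\beta}(\boldsymbol s,\boldsymbol t,z)=\epsilon_{\alpha\beta}(\boldsymbol s)\frac{\tau(\boldsymbol s+\boldsymbol e_\alpha-\boldsymbol e_\beta,\boldsymbol t-[z^{-1}]_\beta)}{\tau(\boldsymbol s,\boldsymbol t)}z^{s_\beta+\delta_{\alpha\beta}-1}e^{\xi(\boldsymbol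 t_\beta,z)}=\Bigl(\delta_{\alpha\beta}+\sum_{j\ge1}(w_j)_{\alpha\beta}(\boldsymbol s,\boldsymbol t)z^{-j}\Bigr)z^{s_\beta}e^{\xi(\boldsymbol t_\beta,z)},$$ where the entries of the $w_j$ lie in the fraction field of $k[[\boldsymbol t]]$. Put $\partial=\sum_{\kappa=1}^N\partial/\partial t_{\kappa1}$, and let $\hat W=1+\sum_{j\ge1}w_j\partial^{-j}$ and $W=\hat W\operatorname{diag}(\partial^{s_1},\dots,\partial^{s_N})$ be the dressing operators, which are matrix pseudodifferential operators in $\partial$. Let $E_\alpha$ be the matrix unit at $(\alpha,\alpha)$, and let $(\cdot)_+$ and $(\cdot)_-$ denote the parts with nonnegative and with negative powers of $\partial$. Then $\hat W$ and $W$ have unique two-sided inverses, and for all $1\le\alpha\le N$ and $j\ge1$ the following hold. (1) $\displaystyle B_{\alpha j}:=\bigl(W E_\alpha\partial^jW^{-1}\bigr)_+=\bigl(\hat W E_\alpha\partial^j\hat W^{-1}\bigr)_+$ is a matrix differential operator in $\partial$ of order $j$, with leading term $E_\alpha\partial^j$. (2) $\displaystyle \frac{\partial\Psi}{\partial t_{\alpha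 j}}=B_{\alpha j}\Psi.$ (3) $\displaystyle \frac{\partial\hat W}{\partial t_{\alpha j}}\hat W^{-1}=-\bigl(\hat W E_\alpha\partial^j\hat W^{-1}\bigr)_-.$ -/

import Mathlib

/-!
# The `N`-component KP hierarchy

Functions of the times `t_{α j}` (`1 ≤ α ≤ N`, `j ≥ 1`) are formal power series over a field `k` of
characteristic zero, quotients of such functions are elements of the fraction field.
Functions that also depend on `z` are formal power series in the times whose coefficients are
Laurent series in `z⁻¹`, i.e. `LaurentSeries k` with its variable standing for `z⁻¹`.
-/

open scoped BigOperators

namespace MultiKP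

/-- The index `(α, j)` of the time variable `t_{α j}`. -/
abbrev TimeIdx (N : ℕ) : Type := Fin N × ℕ+

/-- Formal power series in the times. -/
abbrev TSeries (N : ℕ) (k : Type*) [Field k] := MvPowerSeries (TimeIdx N) k

/-- Quotients of formal power series in the times. -/
abbrev TField (N : ℕ) (k : Type*) [Field k] := FractionRing (TSeries N k)

/-- Formal power series in the times with coefficients in `k((z⁻¹))`. -/
abbrev TZSeries (N : ℕ) (k : Type*) [Field k] := MvPowerSeries (TimeIdx N) (LaurentSeries k)

/-- Quotients of formal power series in the times with coefficients in `k((z⁻¹))`. -/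
abbrev TZField (N : ℕ) (k : Type*) [Field k] := FractionRing (TZSeries N k)

/-! ### Charges and signs -/

/-- The charge vectors `s = (s_1, …, s_N)` of integers with sum zero. -/
def Charge (N : ℕ) : Type := {s : Fin N → ℤ // ∑ κ, s κ = 0}

/-- `s + e_α - e_β`. -/
def Charge.shift {N : ℕ} (s : Charge N) (α β : Fin N) : Charge N :=
  ⟨s.1 + Pi.single α 1 - Pi.single β 1, by
    simp [Finset.sum_add_distrib, Finset.sum_sub_distrib, s.2]⟩

/-- The Kronecker delta. -/
def delta {N : ℕ} (α β : Fin N) : ℤ := if α = β then 1 else 0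

/-- The sign `ε_{αγ}(s)`: `(-1)^{s_{α+1}+…+s_γ}` if `α < γ`, `1` if `α = γ`, and
`-(-1)^{s_{γ+1}+…+s_α}` if `α > γ`. -/
def eps {N : ℕ} (α γ : Fin N) (s : Charge N) : ℤ :=
  if α < γ then (((-1 : ℤˣ) ^ (∑ κ ∈ Finset.Ioc α γ, s.1 κ) : ℤˣ) : ℤ)
  else if α = γ then 1
  else -(((-1 : ℤˣ) ^ (∑ κ ∈ Finset.Ioc γ α, s.1 κ) : ℤˣ) : ℤ)

/-! ### Dependence on `z` -/

section Series

variable {σ : Type*} {k : Type*} [Field k]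

/-- The Laurent series `z ^ n` in `z⁻¹`. -/
noncomputable def zpow (k : Type*) [Field k] (n : ℤ) : LaurentSeries k :=
  HahnSeries.single (-n) 1

/-- The coefficient of `z ^ n`, a formal power series in the times. -/
noncomputable def zCoeff (n : ℤ) (G : MvPowerSeries σ (LaurentSeries k)) : MvPowerSeries σ k :=
  fun m => (MvPowerSeries.coeff m G).coeff (-n)

end Series

/-- `ξ(t_γ, z) = ∑_{j ≥ 1} t_{γ j} z ^ j`. -/
noncomputable def xi {N : ℕ} (k : Type*) [Field k] (γ : Fin N) : TZSeries N k :=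
  fun m => ∑ i ∈ m.support, if m = Finsupp.single i 1 ∧ i.1 = γ then zpow k (i.2 : ℕ) else 0

theorem coeff_xi_single {N : ℕ} (k : Type*) [Field k] (γ : Fin N) (i : TimeIdx N) :
    MvPowerSeries.coeff (Finsupp.single i 1) (xi k γ) =
      if i.1 = γ then zpow k (i.2 : ℕ) else 0 := by
  change (∑ i' ∈ (Finsupp.single i 1 : TimeIdx N →₀ ℕ).support,
    if Finsupp.single i 1 = Finsupp.single i' 1 ∧ i'.1 = γ then zpow k (i'.2 : ℕ) else 0) = _
  have h : (Finsupp.single i 1 : TimeIdx N →₀ ℕ).support = {i} := by ext; simp [eq_comm]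
  rw [h, Finset.sum_singleton]
  simp

theorem coeff_xi_of_ne {N : ℕ} (k : Type*) [Field k] (γ : Fin N) (m : TimeIdx N →₀ ℕ)
    (hm : ∀ i, m ≠ Finsupp.single i 1) : MvPowerSeries.coeff m (xi k γ) = 0 := by
  change (∑ i' ∈ m.support,
    if m = Finsupp.single i' 1 ∧ i'.1 = γ then zpow k (i'.2 : ℕ) else 0) = _
  exact Finset.sum_eq_zero fun i _ => if_neg fun h => hm i h.1

/-- The exponential `∑ f ^ n / n!` of a formal power series `f` without constant term. -/
noncomputable def expSeries {σ k : Type*} [Field k] [CharZero k]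
    (f : MvPowerSeries σ (LaurentSeries k)) : MvPowerSeries σ (LaurentSeries k) :=
  (PowerSeries.exp k).subst f

/-- The arguments `t + c [z⁻¹]_γ`, that is `t_{αj} + c δ_{αγ} z ^ (-j) / j`.
Here the variable `none` is `z⁻¹`. -/
noncomputable def shiftArg {N : ℕ} {k : Type*} [Field k] (c : k) (γ : Fin N) (i : TimeIdx N) :
    MvPowerSeries (Option (TimeIdx N)) k :=
  MvPowerSeries.X (some i) +
    if i.1 = γ then MvPowerSeries.C (c / ((i.2 : ℕ) : k)) * MvPowerSeries.X none ^ (i.2 : ℕ) else 0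

theorem hasSubst_shiftArg {N : ℕ} {k : Type*} [Field k] (c : k) (γ : Fin N) :
    MvPowerSeries.HasSubst (shiftArg c γ) := by
  refine ⟨fun i => ?_, fun d => ?_⟩
  · have h : MvPowerSeries.constantCoeff (shiftArg c γ i) = 0 := by
      unfold shiftArg
      split_ifs <;> simp
    rw [h]
    exact IsNilpotent.zero
  · have h1 : {i : TimeIdx N | d = Finsupp.single (some i) 1}.Finite :=
      Set.Subsingleton.finite fun a ha b hb => by
        have h := Finsupp.single_left_injective one_ne_zero
          ((show d = _ from ha).symm.trans (show d = _ from hb))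
        exact Option.some_injective _ h
    have h2 : {i : TimeIdx N | i.1 = γ ∧ d = Finsupp.single none (i.2 : ℕ)}.Finite :=
      Set.Subsingleton.finite fun a ha b hb => by
        have h := Finsupp.single_injective _ (ha.2.symm.trans hb.2)
        exact Prod.ext (ha.1.trans hb.1.symm) (PNat.coe_injective h)
    refine (h1.union h2).subset fun i hi => ?_
    by_contra hc
    simp only [Set.mem_union, Set.mem_ofPred_eq, not_or, not_and] at hc
    apply hi
    classical
    unfold shiftArg
    split_ifs with hγ
    · simp [MvPowerSeries.coeff_X, MvPowerSeries.coeff_X_pow, hc.1, hc.2 hγ]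
    · simp [MvPowerSeries.coeff_X, hc.1]

/-- `f(t + c [z⁻¹]_γ)`, expanded in powers of the times and of `z⁻¹`. -/
noncomputable def shiftT {N : ℕ} {k : Type*} [Field k] (c : k) (γ : Fin N) (f : TSeries N k) :
    TZSeries N k :=
  fun m => HahnSeries.ofPowerSeries ℤ k
    (PowerSeries.mk fun l => MvPowerSeries.coeff (Finsupp.optionElim l m) (f.subst (shiftArg c γ)))

theorem zCoeff_shiftT_of_pos {N : ℕ} {k : Type*} [Field k] (c : k) (γ : Fin N) (f : TSeries N k)
    {n : ℤ} (hn : 0 < n) (e : ℤ) (d : ℤ) (hd : d ≤ 0) :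
    zCoeff n (e • (MvPowerSeries.C (zpow k d) * shiftT c γ f)) = 0 := by
  refine MvPowerSeries.ext fun m => ?_
  have h : MvPowerSeries.coeff m (e • (MvPowerSeries.C (zpow k d) * shiftT c γ f)) =
      e • (zpow k d * MvPowerSeries.coeff m (shiftT c γ f)) := by
    rw [map_zsmul, MvPowerSeries.coeff_C_mul]
  change (MvPowerSeries.coeff m (e • (MvPowerSeries.C (zpow k d) * shiftT c γ f))).coeff (-n) = 0
  have h2 : (MvPowerSeries.coeff m (shiftT c γ f)).coeff (-n + d) = 0 := by
    change (HahnSeries.ofPowerSeries ℤ k _).coeff (-n + d) = 0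
    rw [PowerSeries.coeff_coe, if_pos (by omega)]
  rw [h, HahnSeries.coeff_smul, zpow, HahnSeries.coeff_single_mul, sub_neg_eq_add, h2, mul_zero,
    smul_zero]

/-! ### Tau functions -/

/-- A function of `t`, as a function of two independent families of times `t`, `t'`. -/
noncomputable def inT {N : ℕ} {k : Type*} [Field k] (f : TZSeries N k) :
    MvPowerSeries (TimeIdx N ⊕ TimeIdx N) (LaurentSeries k) :=
  MvPowerSeries.rename (Function.Embedding.inl : TimeIdx N ↪ TimeIdx N ⊕ TimeIdx N) f

/-- The function `f(t')`, as a function of two independent families of times `t`, `t'`. -/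
noncomputable def inT' {N : ℕ} {k : Type*} [Field k] (f : TZSeries N k) :
    MvPowerSeries (TimeIdx N ⊕ TimeIdx N) (LaurentSeries k) :=
  MvPowerSeries.rename (Function.Embedding.inr : TimeIdx N ↪ TimeIdx N ⊕ TimeIdx N) f

/-- `τ(s, t)` is a tau function of the `N`-component KP hierarchy: for all `α`, `β`, `s`, `s'`,
identically in `t` and `t'`, the sum over `γ` of `ε_{αγ}(s) ε_{βγ}(s')` times the residue of
`z ^ (s_γ - s'_γ + δ_{αγ} + δ_{βγ} - 2) e ^ ξ(t_γ - t'_γ, z)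
  τ(s + e_α - e_γ, t - [z⁻¹]_γ) τ(s' - e_β + e_γ, t' + [z⁻¹]_γ)` vanishes.
The residue is the coefficient of `z⁻¹`. -/
def IsTau {N : ℕ} {k : Type*} [Field k] [CharZero k] (τ : Charge N → TSeries N k) : Prop :=
  ∀ (α β : Fin N) (s s' : Charge N),
    ∑ γ : Fin N, (eps α γ s * eps β γ s') •
      zCoeff (-1)
        (MvPowerSeries.C (zpow k (s.1 γ - s'.1 γ + delta α γ + delta β γ - 2)) *
          expSeries (inT (xi k γ) - inT' (xi k γ)) *
          inT (shiftT (-1) γ (τ (s.shift α γ))) *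
          inT' (shiftT 1 γ (τ (s'.shift γ β)))) = 0

/-! ### Derivatives -/

instance {σ F : Type*} [Field F] : IsDomain (MvPowerSeries σ F) :=
  NoZeroDivisors.to_isDomain _

/-- The extension of a derivation of a domain to its fraction field, by the quotient rule. -/
noncomputable def fracDeriv {F R : Type*} [CommRing F] [CommRing R] [IsDomain R] [Algebra F R]
    (D : Derivation F R R) (x : FractionRing R) : FractionRing R :=
  let p := IsLocalization.sec (nonZeroDivisors R) x
  algebraMap R (FractionRing R) (D p.1 * p.2 - p.1 * D p.2) /
    algebraMap R (FractionRing R) p.2 ^ 2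

theorem fracDeriv_div {F R : Type*} [CommRing F] [CommRing R] [IsDomain R] [Algebra F R]
    (D : Derivation F R R) (a b : R) (hb : b ≠ 0) :
    fracDeriv D (algebraMap R (FractionRing R) a / algebraMap R (FractionRing R) b) =
      algebraMap R (FractionRing R) (D a * b - a * D b) / algebraMap R (FractionRing R) b ^ 2 := by
  set p := IsLocalization.sec (nonZeroDivisors R)
    (algebraMap R (FractionRing R) a / algebraMap R (FractionRing R) b) with hp
  have hinj := IsFractionRing.injective R (FractionRing R)
  have hq : (p.2 : R) ≠ 0 := nonZeroDivisors.ne_zero p.2.2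
  have hb' : algebraMap R (FractionRing R) b ≠ 0 := fun h => hb (hinj (h.trans (map_zero _).symm))
  have hq' : algebraMap R (FractionRing R) p.2 ≠ 0 := fun h => hq (hinj (h.trans (map_zero _).symm))
  have h1 : algebraMap R (FractionRing R) a / algebraMap R (FractionRing R) b *
      algebraMap R (FractionRing R) p.2 = algebraMap R (FractionRing R) p.1 :=
    IsLocalization.sec_spec (nonZeroDivisors R) _
  have h2 : a * p.2 = p.1 * b := by
    apply hinj
    rw [map_mul, map_mul, ← h1]
    field_simp
  have h3 := congrArg D h2
  simp only [Derivation.leibniz, smul_eq_mul] at h3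
  change algebraMap R (FractionRing R) (D p.1 * p.2 - p.1 * D p.2) /
    algebraMap R (FractionRing R) p.2 ^ 2 = _
  rw [div_eq_div_iff (pow_ne_zero 2 hq') (pow_ne_zero 2 hb'), ← map_pow, ← map_pow, ← map_mul,
    ← map_mul]
  congr 1
  linear_combination (-(p.2 : R) * b) * h3 + (b * D p.2 + (p.2 : R) * D b) * h2

theorem fracDeriv_zero {F R : Type*} [CommRing F] [CommRing R] [IsDomain R] [Algebra F R]
    (D : Derivation F R R) : fracDeriv D 0 = 0 := by
  simpa using fracDeriv_div D 0 1 one_ne_zero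

/-- `∂/∂t_i` on quotients of formal power series in the times, with coefficients in `F`. -/
noncomputable def tDeriv {N : ℕ} {F : Type*} [Field F] (i : TimeIdx N)
    (x : FractionRing (MvPowerSeries (TimeIdx N) F)) :
    FractionRing (MvPowerSeries (TimeIdx N) F) :=
  fracDeriv (MvPowerSeries.pderiv F i) x

/-- `∂/∂t_i` entry by entry. -/
noncomputable def matTDeriv {N : ℕ} {F : Type*} [Field F] (i : TimeIdx N)
    (M : Matrix (Fin N) (Fin N) (FractionRing (MvPowerSeries (TimeIdx N) F))) :
    Matrix (Fin N) (Fin N) (FractionRing (MvPowerSeries (TimeIdx N) F)) :=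
  M.map (tDeriv i)

/-- `∂ = ∂/∂t_{11} + … + ∂/∂t_{N1}`, entry by entry. -/
noncomputable def matDel {N : ℕ} {F : Type*} [Field F]
    (M : Matrix (Fin N) (Fin N) (FractionRing (MvPowerSeries (TimeIdx N) F))) :
    Matrix (Fin N) (Fin N) (FractionRing (MvPowerSeries (TimeIdx N) F)) :=
  ∑ κ : Fin N, matTDeriv (κ, 1) M

theorem matTDeriv_zero {N : ℕ} {F : Type*} [Field F] (i : TimeIdx N) :
    matTDeriv i (0 : Matrix (Fin N) (Fin N) (FractionRing (MvPowerSeries (TimeIdx N) F))) = 0 := by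
  ext a b
  simp [matTDeriv, tDeriv, fracDeriv_zero]

theorem iterate_matDel_zero {N : ℕ} {F : Type*} [Field F] (l : ℕ) :
    matDel^[l] (0 : Matrix (Fin N) (Fin N) (FractionRing (MvPowerSeries (TimeIdx N) F))) = 0 :=
  Function.iterate_fixed (by simp [matDel, matTDeriv_zero]) l

/-! ### Matrix pseudodifferential operators in `∂` -/

/-- A formal matrix pseudodifferential operator `∑_{n ≤ M} a_n ∂ ^ n`; `coeff n` is `a_n`. -/
@[ext]
structure PDO (N : ℕ) (k : Type*) [Field k] where
  coeff : ℤ → Matrix (Fin N) (Fin N) (TField N k)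
  bdd : ∃ M : ℤ, ∀ n, M < n → coeff n = 0

namespace PDO

variable {N : ℕ} {k : Type*} [Field k]

/-- Only finitely many terms contribute to a coefficient of a product. -/
theorem mul_finite_support (P Q : PDO N k) (n : ℤ) :
    (Function.support fun p : ℤ × ℕ =>
      Ring.choose p.1 p.2 •
        (P.coeff p.1 * matDel^[p.2] (Q.coeff (n - p.1 + p.2)))).Finite := by
  obtain ⟨M, hM⟩ := P.bdd
  obtain ⟨M', hM'⟩ := Q.bdd
  refine ((Set.finite_Icc (n - M') M).prod (Set.finite_Iic (M + M' - n).toNat)).subset ?_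
  rintro ⟨m, i⟩ h
  have h1 : m ≤ M := by
    by_contra hc
    exact h (by simp [hM m (not_le.mp hc)])
  have h2 : n - m + i ≤ M' := by
    by_contra hc
    exact h (by simp [hM' _ (not_le.mp hc), iterate_matDel_zero])
  simp only [Set.mem_prod, Set.mem_Icc, Set.mem_Iic]
  omega

/-- The product of operators, from
`(a ∂ ^ m) (b ∂ ^ l) = ∑_{i ≥ 0} (m choose i) a (∂ ^ i b) ∂ ^ (m + l - i)`. -/
noncomputable instance : Mul (PDO N k) where
  mul P Q :=
    { coeff := fun n => ∑ᶠ p : ℤ × ℕ,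
        Ring.choose p.1 p.2 • (P.coeff p.1 * matDel^[p.2] (Q.coeff (n - p.1 + p.2)))
      bdd := by
        obtain ⟨M, hM⟩ := P.bdd
        obtain ⟨M', hM'⟩ := Q.bdd
        refine ⟨M + M', fun n hn => finsum_eq_zero_of_forall_eq_zero ?_⟩
        rintro ⟨m, i⟩
        by_cases h : M < m
        · simp [hM m h]
        · have h2 : M' < n - m + i := by omega
          simp [hM' _ h2, iterate_matDel_zero] }

/-- The operator `a ∂ ^ n`. -/
noncomputable def monomial (n : ℤ) (a : Matrix (Fin N) (Fin N) (TField N k)) : PDO N k where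
  coeff := fun m => if m = n then a else 0
  bdd := ⟨n, fun _ hm => if_neg (ne_of_gt hm)⟩

noncomputable instance : One (PDO N k) := ⟨monomial 0 1⟩

noncomputable instance : Neg (PDO N k) where
  neg P :=
    { coeff := fun n => -P.coeff n
      bdd := by
        obtain ⟨M, hM⟩ := P.bdd
        exact ⟨M, fun n hn => by simp [hM n hn]⟩ }

/-- The differential part `P_+`. -/
noncomputable def posPart (P : PDO N k) : PDO N k where
  coeff := fun n => if 0 ≤ n then P.coeff n else 0
  bdd := by
    obtain ⟨M, hM⟩ := P.bdd
    exact ⟨M, fun n hn => by simp [hM n hn]⟩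

/-- The part `P_-` with the negative powers of `∂`. -/
noncomputable def negPart (P : PDO N k) : PDO N k where
  coeff := fun n => if n < 0 then P.coeff n else 0
  bdd := by
    obtain ⟨M, hM⟩ := P.bdd
    exact ⟨M, fun n hn => by simp [hM n hn]⟩

/-- The derivative of the coefficients with respect to the time `t_i`. -/
noncomputable def timeDeriv (i : TimeIdx N) (P : PDO N k) : PDO N k where
  coeff := fun n => matTDeriv i (P.coeff n)
  bdd := by
    obtain ⟨M, hM⟩ := P.bdd
    exact ⟨M, fun n hn => by rw [hM n hn, matTDeriv_zero]⟩

/-- `Q` is a two-sided inverse of `P`. -/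
def IsInverse (P Q : PDO N k) : Prop := P * Q = 1 ∧ Q * P = 1

open Classical in
/-- The inverse of `P` if there is one, and `1` otherwise. -/
noncomputable def inv (P : PDO N k) : PDO N k :=
  if h : ∃ Q, IsInverse P Q then h.choose else 1

noncomputable instance : Inv (PDO N k) := ⟨inv⟩

/-- `P` is a differential operator of order `j`: no power of `∂` is negative or exceeds `j`, and
the coefficient of `∂ ^ j` is not zero. -/
def IsDiffOpOfOrder (P : PDO N k) (j : ℕ) : Prop :=
  (∀ n, n < 0 → P.coeff n = 0) ∧ (∀ n, (j : ℤ) < n → P.coeff n = 0) ∧ P.coeff j ≠ 0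

/-- The matrix `diag(∂ ^ {s_1}, …, ∂ ^ {s_N})`. -/
noncomputable def diagPow (k : Type*) [Field k] (s : Charge N) : PDO N k where
  coeff := fun n => Matrix.diagonal fun α => if s.1 α = n then 1 else 0
  bdd := by
    refine ⟨∑ α, |s.1 α|, fun n hn => ?_⟩
    ext α β
    have h : s.1 α ≠ n := by
      have h1 : |s.1 α| ≤ ∑ α, |s.1 α| :=
        Finset.single_le_sum (f := fun α => |s.1 α|) (fun _ _ => abs_nonneg _) (Finset.mem_univ α)
      have h2 := le_abs_self (s.1 α)
      omega
    simp [Matrix.diagonal_apply, h]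

end PDO

theorem map_C_injective {σ k : Type*} [Field k] :
    Function.Injective (MvPowerSeries.map (σ := σ) (HahnSeries.C : k →+* LaurentSeries k)) := by
  intro f g h
  ext m
  have := congrArg (MvPowerSeries.coeff m) h
  simp only [MvPowerSeries.coeff_map] at this
  exact HahnSeries.C_injective this

/-- Quotients of functions of the times, as functions of the times and of `z`. -/
noncomputable def incl (N : ℕ) (k : Type*) [Field k] : TField N k →+* TZField N k :=
  IsFractionRing.map (A := TSeries N k) (B := TZSeries N k)
    (j := MvPowerSeries.map (HahnSeries.C : k →+* LaurentSeries k)) map_C_injective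

/-- The action `∑_{n ≥ 0} a_n (∂ ^ n Φ)` on a function of the times and `z` of a differential
operator `P = ∑_{n ≥ 0} a_n ∂ ^ n`. -/
noncomputable def PDO.act {N : ℕ} {k : Type*} [Field k] (P : PDO N k)
    (Φ : Matrix (Fin N) (Fin N) (TZField N k)) : Matrix (Fin N) (Fin N) (TZField N k) :=
  ∑ᶠ n : ℕ, (P.coeff n).map (incl N k) * matDel^[n] Φ

/-! ### The wave function and the dressing operators -/

section Wave

variable {N : ℕ} {k : Type*} [Field k] [CharZero k] (τ : Charge N → TSeries N k) (s : Charge N)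

/-- `ε_{αβ}(s) τ(s + e_α - e_β, t - [z⁻¹]_β) z ^ (δ_{αβ} - 1)`. -/
noncomputable def waveNum (α β : Fin N) : TZSeries N k :=
  eps α β s • (MvPowerSeries.C (zpow k (delta α β - 1)) * shiftT (-1) β (τ (s.shift α β)))

/-- The wave function, the matrix with entries
`ε_{αβ}(s) τ(s + e_α - e_β, t - [z⁻¹]_β) / τ(s, t) z ^ (s_β + δ_{αβ} - 1) e ^ ξ(t_β, z)`. -/
noncomputable def wave : Matrix (Fin N) (Fin N) (TZField N k) :=
  Matrix.of fun α β =>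
    algebraMap (TZSeries N k) (TZField N k)
        (waveNum τ s α β * MvPowerSeries.C (zpow k (s.1 β)) * expSeries (xi k β)) /
      incl N k (algebraMap (TSeries N k) (TField N k) (τ s))

/-- The operator `Ŵ = ∑_{j ≥ 0} w_j ∂ ^ (-j)`, where the matrices `w_j` of functions of the times
are given by `Ψ_{αβ} = (∑_{j ≥ 0} (w_j)_{αβ} z ^ (-j)) z ^ {s_β} e ^ ξ(t_β, z)`. -/
noncomputable def dressHat : PDO N k where
  coeff := fun n => Matrix.of fun α β =>
    algebraMap (TSeries N k) (TField N k) (zCoeff n (waveNum τ s α β)) /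
      algebraMap (TSeries N k) (TField N k) (τ s)
  bdd := by
    refine ⟨0, fun n hn => ?_⟩
    ext α β
    have hd : (delta α β - 1 : ℤ) ≤ 0 := by unfold delta; split_ifs <;> norm_num
    rw [Matrix.of_apply, waveNum, zCoeff_shiftT_of_pos (-1 : k) β _ hn (eps α β s) _ hd]
    simp

/-- The dressing operator `W = Ŵ diag(∂ ^ {s_1}, …, ∂ ^ {s_N})`. -/
noncomputable def dress : PDO N k := dressHat τ s * PDO.diagPow k s

/-- `E_α ∂ ^ j`. -/
noncomputable def unitDel (N : ℕ) (k : Type*) [Field k] (α : Fin N) (j : ℕ+) : PDO N k :=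
  PDO.monomial (j : ℕ) (Matrix.single α α 1)

/-- `B_{αj} = (W E_α ∂ ^ j W⁻¹)_+`. -/
noncomputable def opB (α : Fin N) (j : ℕ+) : PDO N k :=
  (dress τ s * unitDel N k α j * (dress τ s)⁻¹).posPart

end Wave

end MultiKP

/-!
# The Lax and Sato equations of the `N`-component KP hierarchy

The matrix pseudodifferential operators form a ring; associativity is checked on monomials
`a ∂ ^ m`, where it is the Vandermonde identity, and extends to all operators because a coefficient
of a product only sees finitely many coefficients of the factors (`PDO.addHom_ext`). In this ring
`1 + (negative order)` is inverted by a geometric series (`PDO.exists_isInverse`).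

The symbol of an operator `X = ∑ a_n ∂ ^ n` is the matrix `u = ∑ a_n z ^ n`; then `X e = u e` for
`e = diag(e ^ ξ(t_β, z))`. On symbols with denominators that do not depend on `z`, which are
determined by their operators (`HasSymbol.unique`), the derivative `∂/∂t_i` of `u e`, with
`i = (α, j)`, corresponds to the operator `covPDO i X = ∂X/∂t_i + X E_α ∂ ^ j`, and `∂` to `∂ X`.

Only the case `s' = s` of the bilinear identity is needed. It is stable under differentiation in
`t`; after any number of differentiations one sets `t' = t`, so that the exponential becomes `1`, and
obtains that the symbols of `∂ ^ n Ŵ` and of `∂ ^ n X`, where `X = covPDO i Ŵ`, have residue zero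
against the dual wave function `b(z) = τ + O(z⁻¹)` (`IsBilinear.isOrthogonal`). The operators with
this property form a left module over the differential operators, so it also contains
`Y = X - (X Ŵ⁻¹)_+ Ŵ = (X Ŵ⁻¹)_- Ŵ`, which has negative order. If `Y` had the leading term
`a ∂ ^ (-n - 1)`, the residue of `∂ ^ n Y` against `b` would be `a τ`; so `Y = 0`
(`IsOrthogonal.eq_zero`), and `(∂Ŵ/∂t_i + Ŵ E_α ∂ ^ j) Ŵ⁻¹` is a differential operator
(`negPart_covPDO_mul_inv`). As `∂Ŵ/∂t_i` has negative order, the two parts of this operator are the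
Sato equation and the formula for `B_{α j}`, and the resulting identity `covPDO i Ŵ = B_{α j} Ŵ`,
read on symbols, is the linear equation for the wave function.
-/

namespace MultiKP

/-! ### Derivations of fields of fractions and of matrices -/

section Derivations

variable {F R : Type*} [CommRing F] [CommRing R] [IsDomain R] [Algebra F R] (D : Derivation F R R)

theorem fracDeriv_algebraMap (a : R) :
    fracDeriv D (algebraMap R (FractionRing R) a) = algebraMap R (FractionRing R) (D a) := by
  simpa using fracDeriv_div D a 1 one_ne_zero

theorem fracDeriv_add (x y : FractionRing R) :
    fracDeriv D (x + y) = fracDeriv D x + fracDeriv D y := by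
  have hinj := IsFractionRing.injective R (FractionRing R)
  obtain ⟨a, b, hb, rfl⟩ := IsFractionRing.div_surjective (A := R) x
  obtain ⟨c, d, hd, rfl⟩ := IsFractionRing.div_surjective (A := R) y
  have hb0 := nonZeroDivisors.ne_zero hb
  have hd0 := nonZeroDivisors.ne_zero hd
  have hb' : algebraMap R (FractionRing R) b ≠ 0 := fun h => hb0 (hinj (h.trans (map_zero _).symm))
  have hd' : algebraMap R (FractionRing R) d ≠ 0 := fun h => hd0 (hinj (h.trans (map_zero _).symm))
  rw [div_add_div _ _ hb' hd', ← map_mul, ← map_mul, ← map_mul, ← map_add,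
    fracDeriv_div D _ _ (mul_ne_zero hb0 hd0), fracDeriv_div D _ _ hb0, fracDeriv_div D _ _ hd0]
  simp only [map_add, Derivation.leibniz, smul_eq_mul, map_mul, map_sub]
  field_simp
  ring

theorem fracDeriv_mul (x y : FractionRing R) :
    fracDeriv D (x * y) = fracDeriv D x * y + x * fracDeriv D y := by
  have hinj := IsFractionRing.injective R (FractionRing R)
  obtain ⟨a, b, hb, rfl⟩ := IsFractionRing.div_surjective (A := R) x
  obtain ⟨c, d, hd, rfl⟩ := IsFractionRing.div_surjective (A := R) y
  have hb0 := nonZeroDivisors.ne_zero hb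
  have hd0 := nonZeroDivisors.ne_zero hd
  have hb' : algebraMap R (FractionRing R) b ≠ 0 := fun h => hb0 (hinj (h.trans (map_zero _).symm))
  have hd' : algebraMap R (FractionRing R) d ≠ 0 := fun h => hd0 (hinj (h.trans (map_zero _).symm))
  rw [div_mul_div_comm, ← map_mul, ← map_mul,
    fracDeriv_div D _ _ (mul_ne_zero hb0 hd0), fracDeriv_div D _ _ hb0, fracDeriv_div D _ _ hd0]
  simp only [Derivation.leibniz, smul_eq_mul, map_mul, map_sub, map_add]
  field_simp
  ring

end Derivations

section MatrixDerivations

variable {N : ℕ} {F : Type*} [Field F]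

local notation "K" => FractionRing (MvPowerSeries (TimeIdx N) F)

/-- `∂/∂t_i` on quotients of power series, as an additive map. -/
noncomputable def tDerivHom (i : TimeIdx N) : K →+ K :=
  AddMonoidHom.mk' (tDeriv i) (fracDeriv_add _)

theorem coe_tDerivHom (i : TimeIdx N) : ⇑(tDerivHom i : K →+ K) = tDeriv i := rfl

theorem tDeriv_algebraMap (i : TimeIdx N) (a : MvPowerSeries (TimeIdx N) F) :
    tDeriv i (algebraMap _ K a) = algebraMap _ K (MvPowerSeries.pderiv F i a) :=
  fracDeriv_algebraMap _ a

theorem tDeriv_mul (i : TimeIdx N) (x y : K) :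
    tDeriv i (x * y) = tDeriv i x * y + x * tDeriv i y := fracDeriv_mul _ x y

theorem matTDeriv_add (i : TimeIdx N) (A B : Matrix (Fin N) (Fin N) K) :
    matTDeriv i (A + B) = matTDeriv i A + matTDeriv i B := by
  ext a b
  exact fracDeriv_add _ _ _

theorem matTDeriv_mul (i : TimeIdx N) (A B : Matrix (Fin N) (Fin N) K) :
    matTDeriv i (A * B) = matTDeriv i A * B + A * matTDeriv i B := by
  ext a b
  simp only [matTDeriv, Matrix.map_apply, Matrix.mul_apply, Matrix.add_apply,
    ← Finset.sum_add_distrib, ← coe_tDerivHom, map_sum]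
  exact Finset.sum_congr rfl fun c _ => tDeriv_mul _ _ _

theorem matTDeriv_one (i : TimeIdx N) : matTDeriv i (1 : Matrix (Fin N) (Fin N) K) = 0 := by
  have h := matTDeriv_mul i (1 : Matrix (Fin N) (Fin N) K) 1
  simpa using h

/-- `∂` as an additive endomorphism of the matrices. -/
noncomputable def matDelHom : Matrix (Fin N) (Fin N) K →+ Matrix (Fin N) (Fin N) K :=
  AddMonoidHom.mk' matDel fun A B => by
    simp only [matDel, matTDeriv_add, Finset.sum_add_distrib]

theorem coe_matDelHom : ⇑(matDelHom : Matrix (Fin N) (Fin N) K →+ _) = matDel := rfl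

theorem matDel_mul (A B : Matrix (Fin N) (Fin N) K) :
    matDel (A * B) = matDel A * B + A * matDel B := by
  simp only [matDel, matTDeriv_mul, Finset.sum_add_distrib, Matrix.sum_mul, Matrix.mul_sum]

theorem matDel_one : matDel (1 : Matrix (Fin N) (Fin N) K) = 0 := by
  simp [matDel, matTDeriv_one]

theorem iterate_matDel_add (n : ℕ) (A B : Matrix (Fin N) (Fin N) K) :
    matDel^[n] (A + B) = matDel^[n] A + matDel^[n] B := by
  simpa only [coe_matDelHom] using iterate_map_add (matDelHom (N := N) (F := F)) n A B

theorem iterate_matDel_zsmul (n : ℕ) (c : ℤ) (A : Matrix (Fin N) (Fin N) K) :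
    matDel^[n] (c • A) = c • matDel^[n] A := by
  induction n with
  | zero => rfl
  | succ n ih =>
    rw [Function.iterate_succ_apply', Function.iterate_succ_apply', ih, ← coe_matDelHom, map_zsmul]

/-- The Leibniz rule for iterates of `∂`. -/
theorem iterate_matDel_mul (n : ℕ) (A B : Matrix (Fin N) (Fin N) K) :
    matDel^[n] (A * B) =
      ∑ p ∈ Finset.HasAntidiagonal.antidiagonal n,
        n.choose p.1 • (matDel^[p.1] A * matDel^[p.2] B) := by
  induction n with
  | zero => simp
  | succ n ih =>
    rw [Finset.sum_antidiagonal_choose_succ_nsmul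
      (fun i j => matDel^[i] A * matDel^[j] B) n, Function.iterate_succ_apply', ih,
      ← coe_matDelHom]
    simp only [Function.iterate_succ_apply', map_sum, map_nsmul, coe_matDelHom, matDel_mul,
      smul_add, Finset.sum_add_distrib]
    rw [add_comm, add_right_inj]
    refine Finset.sum_congr rfl fun p hp => ?_
    rw [Nat.choose_symm_of_eq_add (Finset.HasAntidiagonal.mem_antidiagonal.1 hp).symm]

theorem iterate_matDel_eq_zero {A : Matrix (Fin N) (Fin N) K} (h : matDel A = 0) {n : ℕ}
    (hn : n ≠ 0) : matDel^[n] A = 0 := by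
  obtain ⟨m, rfl⟩ := Nat.exists_eq_succ_of_ne_zero hn
  rw [Function.iterate_succ_apply, h, iterate_matDel_zero]

theorem matTDeriv_single_one (i : TimeIdx N) (α β : Fin N) :
    matTDeriv i (Matrix.single α β (1 : K)) = 0 := by
  ext a b
  have h1 : tDeriv i (1 : K) = 0 := by simpa using tDeriv_mul i (1 : K) 1
  have h0 : tDeriv i (0 : K) = 0 := (tDerivHom i).map_zero
  rw [matTDeriv, Matrix.map_apply, Matrix.single_apply]
  split_ifs <;> simp [h1, h0]

theorem matDel_single_one (α β : Fin N) : matDel (Matrix.single α β (1 : K)) = 0 := by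
  simp [matDel, matTDeriv_single_one]

end MatrixDerivations

/-! ### The additive group of pseudodifferential operators -/

namespace PDO

variable {N : ℕ} {k : Type*} [Field k]

open Finset (range)
open Finset.HasAntidiagonal (antidiagonal mem_antidiagonal)

local notation "𝓜" => Matrix (Fin N) (Fin N) (TField N k)

noncomputable instance : Zero (PDO N k) := ⟨⟨fun _ => 0, 0, fun _ _ => rfl⟩⟩

noncomputable instance : Add (PDO N k) where
  add P Q :=
    { coeff := fun n => P.coeff n + Q.coeff n
      bdd := by
        obtain ⟨M, hM⟩ := P.bdd
        obtain ⟨M', hM'⟩ := Q.bdd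
        refine ⟨max M M', fun n hn => ?_⟩
        rw [hM n (lt_of_le_of_lt (le_max_left _ _) hn),
          hM' n (lt_of_le_of_lt (le_max_right _ _) hn), add_zero] }

theorem coeff_zero (n : ℤ) : (0 : PDO N k).coeff n = 0 := rfl

theorem coeff_add (P Q : PDO N k) (n : ℤ) : (P + Q).coeff n = P.coeff n + Q.coeff n := rfl

theorem coeff_neg (P : PDO N k) (n : ℤ) : (-P).coeff n = -P.coeff n := rfl

theorem coeff_monomial (m n : ℤ) (a : 𝓜) :
    (monomial m a).coeff n = if n = m then a else 0 := rfl

theorem coeff_one (n : ℤ) : (1 : PDO N k).coeff n = if n = 0 then 1 else 0 := rfl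

theorem coeff_mul (P Q : PDO N k) (n : ℤ) :
    (P * Q).coeff n = ∑ᶠ p : ℤ × ℕ,
      ((Ring.choose p.1 p.2 : ℤ) : 𝓜) * (P.coeff p.1 * matDel^[p.2] (Q.coeff (n - p.1 + p.2))) :=
  finsum_congr fun _ => zsmul_eq_mul _ _

theorem mul_finite_support' (P Q : PDO N k) (n : ℤ) :
    (Function.support fun p : ℤ × ℕ =>
      ((Ring.choose p.1 p.2 : ℤ) : 𝓜) *
        (P.coeff p.1 * matDel^[p.2] (Q.coeff (n - p.1 + p.2)))).Finite := by
  refine (mul_finite_support P Q n).subset fun p hp => ?_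
  rw [Function.mem_support] at hp ⊢
  rwa [zsmul_eq_mul]

noncomputable instance : AddCommGroup (PDO N k) where
  add_assoc P Q R := PDO.ext (funext fun _ => add_assoc _ _ _)
  zero_add P := PDO.ext (funext fun _ => zero_add _)
  add_zero P := PDO.ext (funext fun _ => add_zero _)
  add_comm P Q := PDO.ext (funext fun _ => add_comm _ _)
  neg_add_cancel P := PDO.ext (funext fun _ => neg_add_cancel _)
  nsmul := nsmulRec
  zsmul := zsmulRec

/-- The coefficient of `∂ ^ n`, as an additive map. -/
noncomputable def coeffHom (n : ℤ) : PDO N k →+ 𝓜 where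
  toFun P := P.coeff n
  map_zero' := rfl
  map_add' _ _ := rfl

theorem coeff_sub (P Q : PDO N k) (n : ℤ) : (P - Q).coeff n = P.coeff n - Q.coeff n :=
  map_sub (coeffHom n) P Q

theorem coeff_sum {ι : Type*} (t : Finset ι) (P : ι → PDO N k) (n : ℤ) :
    (∑ c ∈ t, P c).coeff n = ∑ c ∈ t, (P c).coeff n :=
  map_sum (coeffHom n) P t

protected theorem add_mul (P Q R : PDO N k) : (P + Q) * R = P * R + Q * R := by
  refine PDO.ext (funext fun n => ?_)
  rw [coeff_add, coeff_mul, coeff_mul, coeff_mul,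
    ← finsum_add_distrib (mul_finite_support' P R n) (mul_finite_support' Q R n)]
  exact finsum_congr fun p => by rw [coeff_add, add_mul, mul_add]

protected theorem mul_add (P Q R : PDO N k) : P * (Q + R) = P * Q + P * R := by
  refine PDO.ext (funext fun n => ?_)
  rw [coeff_add, coeff_mul, coeff_mul, coeff_mul,
    ← finsum_add_distrib (mul_finite_support' P Q n) (mul_finite_support' P R n)]
  exact finsum_congr fun p => by rw [coeff_add, iterate_matDel_add, mul_add, mul_add]

noncomputable instance : NonUnitalNonAssocRing (PDO N k) where
  left_distrib := PDO.mul_add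
  right_distrib := PDO.add_mul
  zero_mul P := by
    have h := PDO.add_mul 0 0 P
    rwa [add_zero, left_eq_add] at h
  mul_zero P := by
    have h := PDO.mul_add P 0 0
    rwa [add_zero, left_eq_add] at h

/-! ### The order -/

/-- `P` has order at most `M`. -/
def OrderLE (P : PDO N k) (M : ℤ) : Prop := ∀ n, M < n → P.coeff n = 0

theorem OrderLE.mono {P : PDO N k} {M M' : ℤ} (h : P.OrderLE M) (hM : M ≤ M') : P.OrderLE M' :=
  fun n hn => h n (hM.trans_lt hn)

theorem OrderLE.add {P Q : PDO N k} {M : ℤ} (hP : P.OrderLE M) (hQ : Q.OrderLE M) :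
    (P + Q).OrderLE M := fun n hn => by rw [coeff_add, hP n hn, hQ n hn, add_zero]

theorem OrderLE.neg {P : PDO N k} {M : ℤ} (hP : P.OrderLE M) :
    (-P).OrderLE M := fun n hn => by rw [coeff_neg, hP n hn, neg_zero]

theorem orderLE_monomial (m : ℤ) (a : 𝓜) : (monomial m a).OrderLE m :=
  fun _ hn => if_neg (ne_of_gt hn)

theorem orderLE_one : (1 : PDO N k).OrderLE 0 := orderLE_monomial 0 1

theorem OrderLE.mul {P Q : PDO N k} {M M' : ℤ} (hP : P.OrderLE M) (hQ : Q.OrderLE M') :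
    (P * Q).OrderLE (M + M') := by
  refine fun n hn => finsum_eq_zero_of_forall_eq_zero ?_
  rintro ⟨m, i⟩
  by_cases h : M < m
  · simp [hP m h]
  · have h2 : M' < n - m + i := by omega
    simp [hQ _ h2, iterate_matDel_zero]

/-- The symbol of leading order is multiplicative. -/
theorem coeff_mul_top {P Q : PDO N k} {M M' : ℤ} (hP : P.OrderLE M) (hQ : Q.OrderLE M') :
    (P * Q).coeff (M + M') = P.coeff M * Q.coeff M' := by
  rw [coeff_mul, finsum_eq_single _ ((M, 0) : ℤ × ℕ)]
  · simp
  · rintro ⟨m, i⟩ h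
    by_cases h1 : M < m
    · simp [hP m h1]
    · have h2 : M' < M + M' - m + i := by
        by_contra hc
        exact h (Prod.ext (by simp only; omega) (by simp only; omega))
      simp [hQ _ h2, iterate_matDel_zero]

/-- An additive map that raises orders by a bounded amount is determined by its values on the
operators `a ∂ ^ m`, since each coefficient of its value depends on finitely many coefficients of the
argument. -/
theorem addHom_ext {f g : PDO N k →+ PDO N k} (c : ℤ)
    (hf : ∀ X L, OrderLE X L → (f X).OrderLE (L + c))
    (hg : ∀ X L, OrderLE X L → (g X).OrderLE (L + c))
    (h : ∀ m a, f (monomial m a) = g (monomial m a)) : f = g := by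
  refine AddMonoidHom.ext fun X => PDO.ext (funext fun n => ?_)
  obtain ⟨M, hM⟩ := X.bdd
  -- `Y` consists of the terms of `X` that can contribute to the coefficient of `∂ ^ n`.
  set Y := ∑ m ∈ Finset.Icc (n - c) M, monomial m (X.coeff m) with hY
  have hZ : (X - Y).OrderLE (n - c - 1) := by
    intro l hl
    rw [coeff_sub, hY, coeff_sum]
    simp only [coeff_monomial]
    rw [Finset.sum_ite_eq]
    split_ifs with hmem
    · exact sub_self _
    · have : M < l := by
        by_contra hc
        exact hmem (Finset.mem_Icc.mpr ⟨by omega, by omega⟩)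
      rw [hM l this, sub_zero]
  have hX : X = Y + (X - Y) := by abel
  rw [hX, map_add, map_add, coeff_add, coeff_add, hf _ _ hZ n (by omega), hg _ _ hZ n (by omega)]
  congr 2
  rw [hY, map_sum, map_sum]
  exact Finset.sum_congr rfl fun m _ => h m _

/-! ### Products with monomials and associativity -/

open Classical in
theorem coeff_monomial_mul (m : ℤ) (a : 𝓜) (X : PDO N k) (n : ℤ) :
    (monomial m a * X).coeff n =
      ∑ᶠ i : ℕ, ((Ring.choose m i : ℤ) : 𝓜) * (a * matDel^[i] (X.coeff (n - m + i))) := by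
  have hinj : Function.Injective fun i : ℕ => (m, i) := fun i j h => (Prod.ext_iff.mp h).2
  have h := finsum_mem_range (f := fun p : ℤ × ℕ => ((Ring.choose p.1 p.2 : ℤ) : 𝓜) *
      ((monomial m a).coeff p.1 * matDel^[p.2] (X.coeff (n - p.1 + p.2)))) hinj
  simp only [coeff_monomial, if_true] at h
  rw [← h, coeff_mul]
  refine finsum_congr fun p => ?_
  by_cases hp : p.1 = m
  · have : p ∈ Set.range fun i : ℕ => (m, i) := ⟨p.2, by rw [← hp]⟩
    rw [finsum_eq_if, if_pos this, coeff_monomial]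
  · have : p ∉ Set.range fun i : ℕ => (m, i) := by
      rintro ⟨i, rfl⟩
      exact hp rfl
    rw [finsum_eq_if, if_neg this, coeff_monomial, if_neg hp, zero_mul, mul_zero]

open Classical in
theorem coeff_mul_monomial (X : PDO N k) (r : ℤ) (c : 𝓜) (n : ℤ) :
    (X * monomial r c).coeff n =
      ∑ᶠ i : ℕ, ((Ring.choose (n - r + i) i : ℤ) : 𝓜) * (X.coeff (n - r + i) * matDel^[i] c) := by
  have hinj : Function.Injective fun i : ℕ => (n - r + i, i) :=
    fun i j h => (Prod.ext_iff.mp h).2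
  have h := finsum_mem_range (f := fun p : ℤ × ℕ => ((Ring.choose p.1 p.2 : ℤ) : 𝓜) *
      (X.coeff p.1 * matDel^[p.2] ((monomial r c).coeff (n - p.1 + p.2)))) hinj
  have h' : ∀ j : ℕ, n - (n - r + j) + j = r := fun j => by omega
  simp only [coeff_monomial, h', if_true] at h
  rw [← h, coeff_mul]
  refine finsum_congr fun p => ?_
  by_cases hp : n - p.1 + p.2 = r
  · have : p ∈ Set.range fun i : ℕ => (n - r + i, i) :=
      ⟨p.2, Prod.ext (by simp only; omega) rfl⟩
    rw [finsum_eq_if, if_pos this, coeff_monomial]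
  · have : p ∉ Set.range fun i : ℕ => (n - r + i, i) := by
      rintro ⟨i, rfl⟩
      exact hp (h' i)
    rw [finsum_eq_if, if_neg this, coeff_monomial, if_neg hp, iterate_matDel_zero, mul_zero,
      mul_zero]

/-- The coefficients of `(a ∂ ^ m) (b ∂ ^ l)`; those of powers above `m + l` vanish. -/
theorem coeff_monomial_mul_monomial (m l : ℤ) (a b : 𝓜) (t : ℕ) :
    (monomial m a * monomial l b).coeff (m + l - t) = ((Ring.choose m t : ℤ) : 𝓜) * (a * matDel^[t] b) := by
  rw [coeff_monomial_mul, finsum_eq_single _ t]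
  · rw [coeff_monomial, if_pos (by omega)]
  · intro i hi
    rw [coeff_monomial, if_neg (by omega), iterate_matDel_zero, mul_zero, mul_zero]

theorem sum_antidiagonal_assoc {A : Type*} [AddCommMonoid A] (t : ℕ) (f : ℕ → ℕ → ℕ → A) :
    ∑ p ∈ antidiagonal t,
        ∑ q ∈ antidiagonal p.1, f q.1 q.2 p.2 =
      ∑ p ∈ antidiagonal t,
        ∑ q ∈ antidiagonal p.2, f p.1 q.1 q.2 := by
  simp only [Finset.sum_sigma']
  refine Finset.sum_nbij' (fun x => ⟨(x.2.1, x.2.2 + x.1.2), (x.2.2, x.1.2)⟩)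
    (fun x => ⟨(x.1.1 + x.2.1, x.2.2), (x.1.1, x.2.1)⟩) ?_ ?_ ?_ ?_ ?_
  · rintro ⟨⟨i, j⟩, ⟨p, q⟩⟩ h
    simp only [Finset.mem_sigma, mem_antidiagonal] at h ⊢
    exact ⟨by omega, trivial⟩
  · rintro ⟨⟨i, j⟩, ⟨p, q⟩⟩ h
    simp only [Finset.mem_sigma, mem_antidiagonal] at h ⊢
    exact ⟨by omega, trivial⟩
  · rintro ⟨⟨i, j⟩, ⟨p, q⟩⟩ h
    simp only [Finset.mem_sigma, mem_antidiagonal] at h ⊢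
    rw [h.2]
  · rintro ⟨⟨i, j⟩, ⟨p, q⟩⟩ h
    simp only [Finset.mem_sigma, mem_antidiagonal] at h ⊢
    rw [h.2]
  · rintro ⟨⟨i, j⟩, ⟨p, q⟩⟩ h
    rfl

/-- Associativity for monomials. The coefficients of
`a (∂ ^ i b) (∂ ^ {h + q} c) ∂ ^ {m + l + r - i - h - q}` on the two sides agree by the identities
`(m choose i + h) (i + h choose i) = (m choose i) (m - i choose h)` and
`∑_{h + q = j} (m - i choose h) (l choose q) = (m - i + l choose j)`. -/
theorem monomial_mul_assoc (m l r : ℤ) (a b c : 𝓜) :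
    monomial m a * monomial l b * monomial r c =
      monomial m a * (monomial l b * monomial r c) := by
  refine PDO.ext (funext fun n => ?_)
  have hab := (orderLE_monomial m a).mul (orderLE_monomial l b)
  have hbc := (orderLE_monomial l b).mul (orderLE_monomial r c)
  by_cases hn : m + l + r < n
  · rw [hab.mul (orderLE_monomial r c) n hn,
      (orderLE_monomial m a).mul hbc n (by omega)]
  obtain ⟨t, ht⟩ := Int.le.dest (not_lt.mp hn)
  obtain rfl : n = m + l + r - t := by omega
  rw [coeff_mul_monomial, coeff_monomial_mul,
    finsum_eq_sum_of_support_subset (s := range (t + 1)),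
    finsum_eq_sum_of_support_subset (s := range (t + 1))]
  rotate_left
  · intro i hi
    by_contra hc
    simp only [Finset.coe_range, Set.mem_Iio, not_lt] at hc
    refine hi ?_
    simp only
    rw [hbc _ (by omega), iterate_matDel_zero, mul_zero, mul_zero]
  · intro i hi
    by_contra hc
    simp only [Finset.coe_range, Set.mem_Iio, not_lt] at hc
    refine hi ?_
    simp only
    rw [hab _ (by omega), zero_mul, mul_zero]
  set T : ℕ → ℕ → ℕ → 𝓜 := fun i h q =>
    ((Ring.choose m i * (Ring.choose (m - i) h * Ring.choose l q) : ℤ) : 𝓜) *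
      (a * (matDel^[i] b * matDel^[h + q] c)) with hT
  trans ∑ p ∈ antidiagonal t,
        ∑ q ∈ antidiagonal p.2, T p.1 q.1 q.2
  · rw [← Finset.sum_range_reflect]
    simp only [Nat.add_sub_cancel]
    rw [← Finset.Nat.sum_antidiagonal_eq_sum_range_succ (fun i j : ℕ =>
      ((Ring.choose (m + l + r - t - r + j) j : ℤ) : 𝓜) *
        ((monomial m a * monomial l b).coeff (m + l + r - t - r + j) * matDel^[j] c))]
    refine Finset.sum_congr rfl fun p hp => ?_
    rw [mem_antidiagonal] at hp
    have e1 : m + l + r - t - r + p.2 = m + l - p.1 := by omega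
    have e2 : m + l - (p.1 : ℤ) = (m - p.1) + l := by omega
    rw [e1, coeff_monomial_mul_monomial, e2, Ring.add_choose_eq _ (Commute.all _ _), Int.cast_sum,
      Finset.sum_mul]
    refine Finset.sum_congr rfl fun q hq => ?_
    rw [mem_antidiagonal] at hq
    rw [hT]
    simp only
    rw [hq, Int.cast_mul (Ring.choose m p.1)]
    simp only [mul_assoc]
    exact (Int.cast_commute (Ring.choose m p.1) _).symm.left_comm _
  · rw [← sum_antidiagonal_assoc, ← Finset.Nat.sum_antidiagonal_eq_sum_range_succ_mk
      (fun p : ℕ × ℕ => ((Ring.choose m p.1 : ℤ) : 𝓜) * (a * matDel^[p.1]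
        ((monomial l b * monomial r c).coeff (m + l + r - t - m + p.1))))]
    refine Finset.sum_congr rfl fun p hp => ?_
    rw [mem_antidiagonal] at hp
    have e1 : m + l + r - t - m + p.1 = l + r - p.2 := by omega
    rw [e1, coeff_monomial_mul_monomial, ← zsmul_eq_mul (_ * _) (Ring.choose l p.2),
      iterate_matDel_zsmul, iterate_matDel_mul, zsmul_eq_mul]
    simp only [Finset.mul_sum]
    refine Finset.sum_congr rfl fun q hq => ?_
    rw [mem_antidiagonal] at hq
    have e3 : Ring.choose m q.1 * (Ring.choose (m - q.1) q.2 * Ring.choose l p.2) =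
        Ring.choose m p.1 * Ring.choose l p.2 * (p.1.choose q.1 : ℤ) := by
      have h := Ring.choose_smul_choose m (show q.1 ≤ p.1 by omega)
      rw [show p.1 - q.1 = q.2 by omega, nsmul_eq_mul] at h
      linear_combination (-Ring.choose l p.2) * h
    rw [hT]
    simp only
    rw [e3, nsmul_eq_mul, ← (Int.cast_commute (Ring.choose l p.2) a).left_comm,
      ← (Nat.cast_commute (p.1.choose q.1) a).left_comm, Function.iterate_add_apply]
    simp only [Int.cast_mul, Int.cast_natCast, mul_assoc]

theorem OrderLE.mulLeft {X : PDO N k} {L M : ℤ} {P : PDO N k} (hX : X.OrderLE L)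
    (hP : P.OrderLE M) : (P * X).OrderLE (L + M) := add_comm M L ▸ hP.mul hX

protected theorem mul_assoc (P Q R : PDO N k) : P * Q * R = P * (Q * R) := by
  obtain ⟨M, hM : P.OrderLE M⟩ := P.bdd
  obtain ⟨M', hM' : Q.OrderLE M'⟩ := Q.bdd
  -- The factors `R`, `Q`, `P` are reduced to monomials one after the other.
  have h1 : ∀ (m l : ℤ) (a b : 𝓜) (R : PDO N k),
      monomial m a * monomial l b * R = monomial m a * (monomial l b * R) := by
    intro m l a b R
    refine DFunLike.congr_fun (addHom_ext (f := AddMonoidHom.mulLeft (monomial m a * monomial l b))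
      (g := (AddMonoidHom.mulLeft (monomial m a)).comp (AddMonoidHom.mulLeft (monomial l b)))
      (l + m) (fun X L hX => ?_) (fun X L hX => ?_) (fun r c => ?_)) R
    · exact (hX.mulLeft ((orderLE_monomial m a).mul (orderLE_monomial l b))).mono (by omega)
    · exact ((hX.mulLeft (orderLE_monomial l b)).mulLeft (orderLE_monomial m a)).mono (by omega)
    · exact monomial_mul_assoc m l r a b c
  obtain ⟨M'', hM'' : R.OrderLE M''⟩ := R.bdd
  have h2 : ∀ (m : ℤ) (a : 𝓜) (Q : PDO N k),
      monomial m a * Q * R = monomial m a * (Q * R) := by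
    intro m a Q
    refine DFunLike.congr_fun (addHom_ext
      (f := (AddMonoidHom.mulRight R).comp (AddMonoidHom.mulLeft (monomial m a)))
      (g := (AddMonoidHom.mulLeft (monomial m a)).comp (AddMonoidHom.mulRight R))
      (m + M'') (fun X L hX => ?_) (fun X L hX => ?_) (fun r c => ?_)) Q
    · exact ((hX.mulLeft (orderLE_monomial m a)).mul hM'').mono (by omega)
    · exact ((hX.mul hM'').mulLeft (orderLE_monomial m a)).mono (by omega)
    · exact h1 m r a c R
  refine DFunLike.congr_fun (addHom_ext
    (f := (AddMonoidHom.mulRight R).comp (AddMonoidHom.mulRight Q))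
    (g := AddMonoidHom.mulRight (Q * R))
    (M' + M'') (fun X L hX => ?_) (fun X L hX => ?_) (fun r c => ?_)) P
  · exact ((hX.mul hM').mul hM'').mono (by omega)
  · exact hX.mul (hM'.mul hM'')
  · exact h2 r c Q

/-! ### The ring of pseudodifferential operators -/

theorem coeff_monomial_zero_mul (a : 𝓜) (X : PDO N k) (n : ℤ) :
    (monomial 0 a * X).coeff n = a * X.coeff n := by
  rw [coeff_monomial_mul, finsum_eq_single _ 0]
  · simp
  · intro i hi
    rw [Ring.choose_zero_pos ℤ (Nat.pos_of_ne_zero hi), Int.cast_zero, zero_mul]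

/-- Right multiplication by `c ∂ ^ r` with a constant `c`. -/
theorem coeff_mul_monomial_of_const (X : PDO N k) (r : ℤ) {c : 𝓜} (hc : matDel c = 0) (n : ℤ) :
    (X * monomial r c).coeff n = X.coeff (n - r) * c := by
  rw [coeff_mul_monomial, finsum_eq_single _ 0]
  · simp
  · intro i hi
    rw [iterate_matDel_eq_zero hc hi, mul_zero, mul_zero]

protected theorem one_mul (P : PDO N k) : 1 * P = P := by
  refine PDO.ext (funext fun n => ?_)
  change (monomial 0 1 * P).coeff n = _
  rw [coeff_monomial_zero_mul, one_mul]

protected theorem mul_one (P : PDO N k) : P * 1 = P := by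
  refine PDO.ext (funext fun n => ?_)
  change (P * monomial 0 1).coeff n = _
  rw [coeff_mul_monomial_of_const P 0 matDel_one, mul_one, sub_zero]

noncomputable instance : Ring (PDO N k) where
  mul_assoc := PDO.mul_assoc
  one_mul := PDO.one_mul
  mul_one := PDO.mul_one
  zsmul := zsmulRec
  neg_add_cancel := neg_add_cancel

theorem monomial_mul_monomial_of_const (m l : ℤ) (a : 𝓜) {b : 𝓜} (hb : matDel b = 0) :
    monomial m a * monomial l b = monomial (m + l) (a * b) := by
  refine PDO.ext (funext fun n => ?_)
  rw [coeff_mul_monomial_of_const _ _ hb, coeff_monomial, coeff_monomial]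
  by_cases h : n = m + l
  · rw [if_pos h, if_pos (by omega)]
  · rw [if_neg h, if_neg (by omega), zero_mul]

/-- The operator `∂`. -/
noncomputable def del : PDO N k := monomial 1 1

theorem del_pow (n : ℕ) : (del : PDO N k) ^ n = monomial n 1 := by
  induction n with
  | zero => rfl
  | succ n ih => rw [pow_succ, ih, del, monomial_mul_monomial_of_const _ _ _ matDel_one]; simp

theorem monomial_eq_mul_del_pow (n : ℕ) (a : 𝓜) :
    monomial n a = monomial 0 a * del ^ n := by
  rw [del_pow, monomial_mul_monomial_of_const _ _ _ matDel_one, mul_one, zero_add]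

theorem coeff_del_mul (X : PDO N k) (n : ℤ) :
    (del * X).coeff n = X.coeff (n - 1) + matDel (X.coeff n) := by
  rw [del, coeff_monomial_mul, finsum_eq_sum_of_support_subset (s := range 2)]
  · simp [Finset.sum_range_succ]
  · intro i hi
    by_contra hc
    simp only [Finset.coe_range, Set.mem_Iio, not_lt] at hc
    refine hi ?_
    have h : Ring.choose (1 : ℤ) i = 0 := by
      have := Ring.choose_natCast (R := ℤ) 1 i
      rw [Nat.choose_eq_zero_of_lt (by omega)] at this
      simpa using this
    simp only [h, Int.cast_zero, zero_mul]

theorem orderLE_del_pow (n : ℕ) : (del ^ n : PDO N k).OrderLE n := by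
  rw [del_pow]
  exact orderLE_monomial _ _

/-! ### Inverses -/

theorem IsInverse.unique {P Q Q' : PDO N k} (h : IsInverse P Q) (h' : IsInverse P Q') :
    Q = Q' := left_inv_eq_right_inv h.2 h'.1

theorem IsInverse.mul {P P' Q Q' : PDO N k} (h : IsInverse P Q) (h' : IsInverse P' Q') :
    IsInverse (P * P') (Q' * Q) := by
  constructor
  · rw [mul_assoc, ← mul_assoc P', h'.1, one_mul, h.1]
  · rw [mul_assoc, ← mul_assoc Q, h.2, one_mul, h'.2]

theorem IsInverse.inv_eq {P Q : PDO N k} (h : IsInverse P Q) : P⁻¹ = Q := by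
  have hex : ∃ Q, IsInverse P Q := ⟨Q, h⟩
  have h1 : P⁻¹ = hex.choose := dif_pos hex
  rw [h1]
  exact hex.choose_spec.unique h

theorem orderLE_pow_of_neg {U : PDO N k} (hU : U.OrderLE (-1)) (n : ℕ) :
    (U ^ n).OrderLE (-n) := by
  induction n with
  | zero => exact orderLE_one
  | succ n ih =>
    rw [pow_succ]
    exact (ih.mul hU).mono (by push_cast; omega)

/-- The sum of the geometric series `∑ U ^ i` for an operator `U` of negative order. Only the powers
`U ^ i` with `i ≤ -n` contribute to the coefficient of `∂ ^ n`. -/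
noncomputable def geom (U : PDO N k) : PDO N k where
  coeff n := if n ≤ 0 then (∑ i ∈ range ((-n).toNat + 1), U ^ i).coeff n else 0
  bdd := ⟨0, fun _ hn => if_neg (not_le.mpr hn)⟩

theorem geom_sub_orderLE {U : PDO N k} (hU : U.OrderLE (-1)) (m : ℕ) :
    (geom U - ∑ i ∈ range m, U ^ i).OrderLE (-m) := by
  intro n hn
  rw [coeff_sub, sub_eq_zero]
  by_cases h : n ≤ 0
  · have h1 : (geom U).coeff n = (∑ i ∈ range ((-n).toNat + 1), U ^ i).coeff n := if_pos h
    obtain ⟨d, rfl⟩ := Nat.exists_eq_add_of_le (show (-n).toNat + 1 ≤ m by omega)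
    rw [h1, Finset.sum_range_add _ ((-n).toNat + 1) d, coeff_add, left_eq_add, coeff_sum]
    exact Finset.sum_eq_zero fun i _ => orderLE_pow_of_neg hU _ n (by push_cast; omega)
  · have h1 : (geom U).coeff n = 0 := if_neg h
    rw [h1, coeff_sum, Finset.sum_eq_zero]
    exact fun i _ => orderLE_pow_of_neg hU _ n (by omega)

theorem isInverse_geom {U : PDO N k} (hU : U.OrderLE (-1)) : IsInverse (1 - U) (geom U) := by
  have h1 : (1 - U).OrderLE 0 := by
    rw [sub_eq_add_neg]
    exact orderLE_one.add (hU.neg.mono (by omega))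
  constructor
  · refine PDO.ext (funext fun n => ?_)
    have e : (1 - U) * geom U = 1 - U ^ (-n).toNat.succ +
        (1 - U) * (geom U - ∑ i ∈ range (-n).toNat.succ, U ^ i) := by
      rw [mul_sub (1 - U), mul_neg_geom_sum]
      abel
    rw [e, coeff_add, coeff_sub, orderLE_pow_of_neg hU _ n (by omega),
      (h1.mul (geom_sub_orderLE hU _)) n (by omega), add_zero, sub_zero]
  · refine PDO.ext (funext fun n => ?_)
    have e : geom U * (1 - U) = 1 - U ^ (-n).toNat.succ +
        (geom U - ∑ i ∈ range (-n).toNat.succ, U ^ i) * (1 - U) := by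
      rw [sub_mul _ _ (1 - U), geom_sum_mul_neg]
      abel
    rw [e, coeff_add, coeff_sub, orderLE_pow_of_neg hU _ n (by omega),
      ((geom_sub_orderLE hU _).mul h1) n (by omega), add_zero, sub_zero]

/-- An operator `1 + (negative order)` has an inverse of the same form. -/
theorem exists_isInverse {P : PDO N k} (hP : P.OrderLE 0) (h0 : P.coeff 0 = 1) :
    ∃ V : PDO N k, IsInverse P V ∧ V.OrderLE 0 ∧ V.coeff 0 = 1 := by
  have hU : (1 - P).OrderLE (-1) := by
    intro n hn
    rw [coeff_sub, coeff_one]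
    by_cases h : n = 0
    · rw [if_pos h, h, h0, sub_self]
    · rw [if_neg h, hP n (by omega), sub_zero]
  have h := isInverse_geom hU
  rw [sub_sub_cancel] at h
  have hV : (geom (1 - P)).OrderLE 0 := fun n hn => if_neg (not_le.mpr hn)
  refine ⟨_, h, hV, ?_⟩
  have h2 := coeff_mul_top hP hV
  rw [h.1, h0, one_mul] at h2
  exact h2.symm

end PDO

/-! ### Coefficients of powers of `z` -/

section ZCoeff

variable {σ τ : Type*} {k : Type*} [Field k]

local notation "𝓛" => LaurentSeries k

theorem coeff_zCoeff (n : ℤ) (G : MvPowerSeries σ 𝓛) (m : σ →₀ ℕ) :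
    MvPowerSeries.coeff m (zCoeff n G) = (MvPowerSeries.coeff m G).coeff (-n) := rfl

theorem zCoeff_add (n : ℤ) (G H : MvPowerSeries σ 𝓛) :
    zCoeff n (G + H) = zCoeff n G + zCoeff n H := by
  refine MvPowerSeries.ext fun m => ?_
  rw [map_add, coeff_zCoeff, coeff_zCoeff, coeff_zCoeff, map_add, HahnSeries.coeff_add]

/-- The coefficient of `z ^ n`, as an additive map. -/
noncomputable def zCoeffHom (n : ℤ) : MvPowerSeries σ 𝓛 →+ MvPowerSeries σ k :=
  AddMonoidHom.mk' (zCoeff n) (zCoeff_add n)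

theorem coe_zCoeffHom (n : ℤ) : ⇑(zCoeffHom n : MvPowerSeries σ 𝓛 →+ _) = zCoeff n := rfl

theorem zCoeff_zero (n : ℤ) : zCoeff n (0 : MvPowerSeries σ 𝓛) = 0 := map_zero (zCoeffHom n)

theorem eq_zero_of_zCoeff {G : MvPowerSeries σ 𝓛} (h : ∀ n, zCoeff n G = 0) : G = 0 := by
  refine MvPowerSeries.ext fun m => ?_
  ext n
  have h1 := congrArg (MvPowerSeries.coeff m) (h (-n))
  rw [coeff_zCoeff, neg_neg] at h1
  simpa using h1

theorem zCoeff_C_zpow_mul (n j : ℤ) (G : MvPowerSeries σ 𝓛) :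
    zCoeff n (MvPowerSeries.C (zpow k j) * G) = zCoeff (n - j) G := by
  refine MvPowerSeries.ext fun m => ?_
  rw [coeff_zCoeff, coeff_zCoeff, MvPowerSeries.coeff_C_mul, zpow, HahnSeries.coeff_single_mul,
    one_mul]
  congr 1
  omega

theorem zCoeff_map_C_mul (n : ℤ) (f : MvPowerSeries σ k) (G : MvPowerSeries σ 𝓛) :
    zCoeff n (MvPowerSeries.map (HahnSeries.C : k →+* 𝓛) f * G) = f * zCoeff n G := by
  classical
  refine MvPowerSeries.ext fun m => ?_
  rw [coeff_zCoeff, MvPowerSeries.coeff_mul, MvPowerSeries.coeff_mul, HahnSeries.coeff_sum]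
  refine Finset.sum_congr rfl fun p _ => ?_
  rw [MvPowerSeries.coeff_map, HahnSeries.C_apply, HahnSeries.coeff_single_zero_mul, coeff_zCoeff]

theorem zCoeff_pderiv (n : ℤ) (i : σ) (G : MvPowerSeries σ 𝓛) :
    zCoeff n (MvPowerSeries.pderiv 𝓛 i G) = MvPowerSeries.pderiv k i (zCoeff n G) := by
  refine MvPowerSeries.ext fun m => ?_
  rw [coeff_zCoeff, MvPowerSeries.coeff_pderiv, MvPowerSeries.coeff_pderiv, coeff_zCoeff,
    ← Nat.cast_succ, ← Nat.cast_succ, mul_comm, ← nsmul_eq_mul, mul_comm, ← nsmul_eq_mul,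
    HahnSeries.coeff_nsmul]
  rfl

theorem zCoeff_rename (n : ℤ) (e : σ → τ) [Filter.TendstoCofinite e] (G : MvPowerSeries σ 𝓛) :
    zCoeff n (MvPowerSeries.rename e G) = MvPowerSeries.rename e (zCoeff n G) := by
  refine MvPowerSeries.ext fun m => ?_
  rw [coeff_zCoeff, MvPowerSeries.coeff_rename, MvPowerSeries.coeff_rename, HahnSeries.coeff_sum]
  rfl

theorem laurent_coeff_mul {a b : 𝓛} {M M' : ℤ} (ha : ∀ m, M < m → a.coeff (-m) = 0)
    (hb : ∀ m, M' < m → b.coeff (-m) = 0) (n : ℤ) :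
    (a * b).coeff (-n) =
      ∑ m ∈ Finset.Icc (n - M') M, a.coeff (-m) * b.coeff (-(n - m)) := by
  rw [HahnSeries.coeff_mul]
  refine Finset.sum_of_injOn (fun p => -p.1) ?_ ?_ ?_ ?_
  · rintro p hp q hq h
    simp only [Finset.mem_coe, Finset.mem_antidiagonal] at hp hq
    have h1 : p.1 = q.1 := neg_injective h
    exact Prod.ext h1 (by have := hp.2.2; have := hq.2.2; omega)
  · rintro p hp
    simp only [Finset.mem_coe, Finset.mem_antidiagonal, HahnSeries.mem_support] at hp
    simp only [Finset.coe_Icc, Set.mem_Icc]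
    constructor
    · by_contra hc
      exact hp.2.1 (by simpa using hb (-p.2) (by omega))
    · by_contra hc
      exact hp.1 (by simpa using ha (-p.1) (by omega))
  · intro m _ hm
    by_contra hc
    refine hm ⟨(-m, -(n - m)), ?_, by simp⟩
    simp only [Finset.mem_coe, Finset.mem_antidiagonal, HahnSeries.mem_support]
    exact ⟨left_ne_zero_of_mul hc, right_ne_zero_of_mul hc, by omega⟩
  · rintro p hp
    simp only [Finset.mem_antidiagonal] at hp
    have : -(n - -p.1) = p.2 := by omega
    rw [this, neg_neg]

/-- The coefficients of a product of two functions with bounded powers of `z`. -/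
theorem zCoeff_mul {f g : MvPowerSeries σ 𝓛} {M M' : ℤ} (hf : ∀ m, M < m → zCoeff m f = 0)
    (hg : ∀ m, M' < m → zCoeff m g = 0) (n : ℤ) :
    zCoeff n (f * g) = ∑ m ∈ Finset.Icc (n - M') M, zCoeff m f * zCoeff (n - m) g := by
  classical
  refine MvPowerSeries.ext fun d => ?_
  rw [coeff_zCoeff, MvPowerSeries.coeff_mul, HahnSeries.coeff_sum, map_sum]
  simp only [MvPowerSeries.coeff_mul]
  rw [Finset.sum_comm]
  refine Finset.sum_congr rfl fun p _ => ?_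
  rw [laurent_coeff_mul (M := M) (M' := M')]
  · rfl
  · intro m hm
    rw [← coeff_zCoeff, hf m hm, map_zero]
  · intro m hm
    rw [← coeff_zCoeff, hg m hm, map_zero]

theorem pderiv_map_C (i : σ) (f : MvPowerSeries σ k) :
    MvPowerSeries.pderiv 𝓛 i (MvPowerSeries.map (HahnSeries.C : k →+* 𝓛) f) =
      MvPowerSeries.map (HahnSeries.C : k →+* 𝓛) (MvPowerSeries.pderiv k i f) := by
  refine MvPowerSeries.ext fun m => ?_
  rw [MvPowerSeries.coeff_pderiv, MvPowerSeries.coeff_map, MvPowerSeries.coeff_map,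
    MvPowerSeries.coeff_pderiv, map_mul, map_add, map_natCast, map_one]

end ZCoeff

/-! ### Exponentials -/

section Exp

variable {σ τ : Type*} {k : Type*} [Field k] [CharZero k]

local notation "𝓛" => LaurentSeries k

/-- The partial sums of the exponential series. -/
noncomputable def expPartial (f : MvPowerSeries σ 𝓛) (M : ℕ) : MvPowerSeries σ 𝓛 :=
  ∑ d ∈ Finset.range M,
    MvPowerSeries.C (algebraMap k 𝓛 (PowerSeries.coeff d (PowerSeries.exp k))) * f ^ d

theorem coeff_expSeries {f : MvPowerSeries σ 𝓛} (hf : MvPowerSeries.constantCoeff f = 0)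
    {m : σ →₀ ℕ} {M : ℕ} (hM : m.degree < M) :
    MvPowerSeries.coeff m (expSeries f) = MvPowerSeries.coeff m (expPartial f M) := by
  rw [expSeries, PowerSeries.coeff_subst (PowerSeries.HasSubst.of_constantCoeff_zero hf),
    finsum_eq_sum_of_support_subset (s := Finset.range M)]
  · rw [expPartial, map_sum]
    exact Finset.sum_congr rfl fun d _ => by rw [MvPowerSeries.coeff_C_mul, Algebra.smul_def]
  · intro d hd
    by_contra hc
    simp only [Finset.coe_range, Set.mem_Iio, not_lt] at hc
    refine hd ?_
    simp only
    rw [MvPowerSeries.coeff_eq_zero_of_constantCoeff_nilpotent (m := 1) (by simpa using hf)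
      (by omega), Algebra.smul_def, mul_zero]

theorem pderiv_expPartial (f : MvPowerSeries σ 𝓛) (i : σ) (M : ℕ) :
    MvPowerSeries.pderiv 𝓛 i (expPartial f (M + 1)) =
      expPartial f M * MvPowerSeries.pderiv 𝓛 i f := by
  rw [expPartial, expPartial, Finset.sum_range_succ', map_add, map_sum, Finset.sum_mul, pow_zero,
    mul_one, MvPowerSeries.pderiv_C, add_zero]
  refine Finset.sum_congr rfl fun d _ => ?_
  rw [Derivation.leibniz, MvPowerSeries.pderiv_C, smul_zero, add_zero, MvPowerSeries.pderiv_pow,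
    Nat.add_sub_cancel, smul_eq_mul, ← mul_assoc, ← mul_assoc]
  congr 2
  rw [← map_natCast (MvPowerSeries.C : 𝓛 →+* MvPowerSeries σ 𝓛), ← map_mul,
    ← map_natCast (algebraMap k 𝓛), ← map_mul]
  congr 3
  rw [PowerSeries.coeff_exp, PowerSeries.coeff_exp, Nat.factorial_succ]
  have h1 : (d.factorial : k) ≠ 0 := Nat.cast_ne_zero.mpr d.factorial_ne_zero
  have h2 : ((d : k) + 1) ≠ 0 := Nat.cast_add_one_ne_zero d
  simp only [map_div₀, map_one, map_natCast]
  push_cast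
  field_simp

theorem pderiv_expSeries {f : MvPowerSeries σ 𝓛} (hf : MvPowerSeries.constantCoeff f = 0)
    (i : σ) : MvPowerSeries.pderiv 𝓛 i (expSeries f) =
      expSeries f * MvPowerSeries.pderiv 𝓛 i f := by
  classical
  refine MvPowerSeries.ext fun m => ?_
  rw [MvPowerSeries.coeff_pderiv, coeff_expSeries hf (M := m.degree + 1 + 1) (by simp),
    ← MvPowerSeries.coeff_pderiv, pderiv_expPartial, MvPowerSeries.coeff_mul,
    MvPowerSeries.coeff_mul]
  refine Finset.sum_congr rfl fun p hp => ?_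
  rw [coeff_expSeries hf]
  rw [← Finset.HasAntidiagonal.mem_antidiagonal.mp hp, map_add]
  omega

theorem rename_expSeries {f : MvPowerSeries σ 𝓛} (hf : MvPowerSeries.constantCoeff f = 0)
    (e : σ → τ) [Filter.TendstoCofinite e] :
    MvPowerSeries.rename e (expSeries f) = expSeries (MvPowerSeries.rename e f) := by
  refine MvPowerSeries.ext fun m => ?_
  have h : MvPowerSeries.rename e (expPartial f (m.degree + 1)) =
      expPartial (MvPowerSeries.rename e f) (m.degree + 1) := by
    simp only [expPartial, map_sum, map_mul, map_pow, MvPowerSeries.rename_C]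
  rw [coeff_expSeries (by rwa [MvPowerSeries.constantCoeff_rename]) (Nat.lt_succ_self _),
    Nat.succ_eq_add_one, ← h, MvPowerSeries.coeff_rename, MvPowerSeries.coeff_rename]
  refine Finset.sum_congr rfl fun p hp => coeff_expSeries hf ?_
  simp only [Set.Finite.mem_toFinset, Set.mem_preimage, Set.mem_singleton_iff] at hp
  rw [← hp, Finsupp.degree_mapDomain]
  omega

theorem expSeries_zero : expSeries (0 : MvPowerSeries σ 𝓛) = 1 := by
  rw [expSeries, PowerSeries.subst_zero_eq_C_constantCoeff]
  simp

end Exp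

/-! ### The exponents `ξ(t_γ, z)` and two families of times -/

section Xi

variable {N : ℕ} {k : Type*} [Field k]

local notation "𝓛" => LaurentSeries k

theorem constantCoeff_xi (γ : Fin N) : MvPowerSeries.constantCoeff (xi k γ) = 0 := by
  rw [← MvPowerSeries.coeff_zero_eq_constantCoeff_apply]
  exact coeff_xi_of_ne k γ 0 fun i h => Finsupp.single_ne_zero.mpr one_ne_zero h.symm

theorem pderiv_xi (γ : Fin N) (i : TimeIdx N) :
    MvPowerSeries.pderiv 𝓛 i (xi k γ) =
      if i.1 = γ then MvPowerSeries.C (zpow k (i.2 : ℕ)) else 0 := by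
  classical
  refine MvPowerSeries.ext fun m => ?_
  rw [MvPowerSeries.coeff_pderiv]
  by_cases hm : m = 0
  · subst hm
    rw [zero_add, coeff_xi_single]
    split_ifs <;> simp
  · rw [coeff_xi_of_ne, zero_mul]
    · split_ifs
      · rw [MvPowerSeries.coeff_C, if_neg hm]
      · simp
    · intro i' h
      have h1 := congrArg Finsupp.degree h
      simp only [map_add, Finsupp.degree_single] at h1
      exact hm ((Finsupp.degree_eq_zero_iff m).mp (by omega))

theorem pderiv_inT (i : TimeIdx N) (f : TZSeries N k) :
    MvPowerSeries.pderiv 𝓛 (Sum.inl i) (inT f) = inT (MvPowerSeries.pderiv 𝓛 i f) := by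
  refine MvPowerSeries.ext fun m => ?_
  rw [MvPowerSeries.coeff_pderiv, inT, inT]
  have hs : (Finsupp.single (Sum.inl i) 1 : TimeIdx N ⊕ TimeIdx N →₀ ℕ) =
      Finsupp.embDomain Function.Embedding.inl (Finsupp.single i 1) := by
    rw [Finsupp.embDomain_single]; rfl
  by_cases hm : m ∈ Set.range (Finsupp.embDomain (Function.Embedding.inl :
      TimeIdx N ↪ TimeIdx N ⊕ TimeIdx N))
  · obtain ⟨y, rfl⟩ := hm
    rw [hs, ← Finsupp.embDomain_add, MvPowerSeries.coeff_embDomain_rename,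
      MvPowerSeries.coeff_embDomain_rename, MvPowerSeries.coeff_pderiv]
    congr 3
    exact_mod_cast Finsupp.embDomain_apply_self (Function.Embedding.inl :
      TimeIdx N ↪ TimeIdx N ⊕ TimeIdx N) y i
  · rw [MvPowerSeries.coeff_rename_eq_zero, MvPowerSeries.coeff_rename_eq_zero, zero_mul]
    · rintro ⟨y, hy⟩
      exact hm ⟨y, by rw [← hy, Finsupp.embDomain_eq_mapDomain]⟩
    · rintro ⟨y, hy⟩
      rw [← Finsupp.embDomain_eq_mapDomain] at hy
      apply hm
      rw [Finsupp.mem_range_embDomain_iff]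
      have h2 := (Finsupp.mem_range_embDomain_iff (Function.Embedding.inl :
        TimeIdx N ↪ TimeIdx N ⊕ TimeIdx N) _).mp ⟨y, hy⟩
      refine fun c hc => h2 ?_
      simp only [Finset.mem_coe, Finsupp.mem_support_iff, Finsupp.add_apply] at hc ⊢
      omega

theorem pderiv_inT' (i : TimeIdx N) (f : TZSeries N k) :
    MvPowerSeries.pderiv 𝓛 (Sum.inl i) (inT' f) = 0 := by
  refine MvPowerSeries.ext fun m => ?_
  rw [MvPowerSeries.coeff_pderiv, inT', MvPowerSeries.coeff_rename_eq_zero, zero_mul, map_zero]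
  rintro ⟨y, hy⟩
  have h1 := DFunLike.congr_fun hy (Sum.inl i)
  rw [Finsupp.mapDomain_of_notMem_range] at h1
  · simp at h1
  · simp

theorem tendstoCofinite_sum_elim (σ : Type*) :
    Filter.TendstoCofinite (Sum.elim id id : σ ⊕ σ → σ) := by
  refine (Filter.tendstoCofinite_iff_finite_preimage_singleton _).mpr fun b => ?_
  refine Set.Finite.subset (Set.toFinite {Sum.inl b, Sum.inr b}) ?_
  rintro (x | x) hx <;> simpa using hx

attribute [local instance] tendstoCofinite_sum_elim

/-- The restriction to `t = t'`. -/
noncomputable def diag : MvPowerSeries (TimeIdx N ⊕ TimeIdx N) 𝓛 →ₐ[𝓛] TZSeries N k :=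
  MvPowerSeries.rename (Sum.elim id id)

theorem diag_inT (f : TZSeries N k) : diag (inT f) = f := by
  rw [diag, inT, MvPowerSeries.rename_rename]
  exact MvPowerSeries.rename_id_apply f

theorem diag_inT' (f : TZSeries N k) : diag (inT' f) = f := by
  rw [diag, inT', MvPowerSeries.rename_rename]
  exact MvPowerSeries.rename_id_apply f

theorem zCoeff_diag_eq_zero {n : ℤ} {f : MvPowerSeries (TimeIdx N ⊕ TimeIdx N) 𝓛}
    (h : zCoeff n f = 0) : zCoeff n (diag f) = 0 := by
  rw [diag, zCoeff_rename, h, map_zero]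

end Xi

/-! ### The bilinear identity -/

section Bilinear

variable {N : ℕ} {k : Type*} [Field k]

local notation "𝓛" => LaurentSeries k

theorem zCoeff_zsmul {σ : Type*} (n : ℤ) (c : ℤ) (G : MvPowerSeries σ 𝓛) :
    zCoeff n (c • G) = c • zCoeff n G := map_zsmul (zCoeffHom n) c G

theorem zCoeff_sum {σ ι : Type*} (n : ℤ) (t : Finset ι) (G : ι → MvPowerSeries σ 𝓛) :
    zCoeff n (∑ c ∈ t, G c) = ∑ c ∈ t, zCoeff n (G c) := map_sum (zCoeffHom n) G t

/-- The derivative `e ^ {-ξ(t_γ, z)} ∂/∂t_i e ^ {ξ(t_γ, z)}`. -/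
noncomputable def covSeries (i : TimeIdx N) (γ : Fin N) (f : TZSeries N k) : TZSeries N k :=
  MvPowerSeries.pderiv 𝓛 i f +
    (if i.1 = γ then MvPowerSeries.C (zpow k (i.2 : ℕ)) else 0) * f

theorem constantCoeff_xi_sub_xi (γ : Fin N) :
    MvPowerSeries.constantCoeff (inT (xi k γ) - inT' (xi k γ)) = 0 := by
  rw [map_sub, inT, inT', MvPowerSeries.constantCoeff_rename, MvPowerSeries.constantCoeff_rename,
    sub_self]

section CharZero

variable [CharZero k]

/-- `e ^ ξ(t_γ - t'_γ, z)`. -/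
noncomputable def expDiff (k : Type*) [Field k] [CharZero k] (γ : Fin N) :
    MvPowerSeries (TimeIdx N ⊕ TimeIdx N) (LaurentSeries k) :=
  expSeries (inT (xi k γ) - inT' (xi k γ))

theorem pderiv_expDiff (i : TimeIdx N) (γ : Fin N) :
    MvPowerSeries.pderiv 𝓛 (Sum.inl i) (expDiff k γ) =
      expDiff k γ * inT (if i.1 = γ then MvPowerSeries.C (zpow k (i.2 : ℕ)) else 0) := by
  rw [expDiff, pderiv_expSeries (constantCoeff_xi_sub_xi γ), map_sub, pderiv_inT, pderiv_inT',
    sub_zero, pderiv_xi]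

theorem diag_expDiff (γ : Fin N) : diag (expDiff k γ) = 1 := by
  have := tendstoCofinite_sum_elim (TimeIdx N)
  rw [expDiff, diag, rename_expSeries (constantCoeff_xi_sub_xi γ)]
  change expSeries (diag _) = 1
  rw [map_sub, diag_inT, diag_inT', sub_self, expSeries_zero]

/-- The bilinear identity
`∑_γ Res_z e ^ ξ(t_γ - t'_γ, z) p_γ(t, z) q_γ(t', z) = 0`. -/
def Bilinear (p q : Fin N → TZSeries N k) : Prop :=
  ∑ γ : Fin N, zCoeff (-1) (expDiff k γ * inT (p γ) * inT' (q γ)) = 0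

theorem Bilinear.sum {ι : Type*} {t : Finset ι} {p : ι → Fin N → TZSeries N k}
    {q : Fin N → TZSeries N k} (h : ∀ c ∈ t, Bilinear (p c) q) :
    Bilinear (fun γ => ∑ c ∈ t, p c γ) q := by
  unfold Bilinear at h ⊢
  have : ∀ γ, zCoeff (-1) (expDiff k γ * inT (∑ c ∈ t, p c γ) * inT' (q γ)) =
      ∑ c ∈ t, zCoeff (-1) (expDiff k γ * inT (p c γ) * inT' (q γ)) := by
    intro γ
    rw [← zCoeff_sum, inT, map_sum, Finset.mul_sum, Finset.sum_mul]
    rfl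
  simp only [this]
  rw [Finset.sum_comm]
  exact Finset.sum_eq_zero h

/-- The bilinear identity may be differentiated with respect to `t`. -/
theorem Bilinear.covSeries {p q : Fin N → TZSeries N k} (h : Bilinear p q) (i : TimeIdx N) :
    Bilinear (fun γ => covSeries i γ (p γ)) q := by
  unfold Bilinear at h ⊢
  have h1 := congrArg (MvPowerSeries.pderiv k (Sum.inl i)) h
  rw [map_sum, map_zero] at h1
  rw [← h1]
  refine Finset.sum_congr rfl fun γ _ => ?_
  rw [← zCoeff_pderiv, Derivation.leibniz, Derivation.leibniz, pderiv_inT', pderiv_inT,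
    pderiv_expDiff]
  congr 1
  simp only [MultiKP.covSeries, inT, map_add, map_mul, smul_eq_mul]
  ring

/-- The bilinear identity on the diagonal `t = t'`. -/
theorem Bilinear.sum_zCoeff_mul {p q : Fin N → TZSeries N k} (h : Bilinear p q) :
    ∑ γ : Fin N, zCoeff (-1) (p γ * q γ) = 0 := by
  unfold Bilinear at h
  rw [← zCoeff_sum] at h ⊢
  have h1 := zCoeff_diag_eq_zero h
  rw [map_sum] at h1
  simpa only [map_mul, diag_expDiff, diag_inT, diag_inT', one_mul] using h1

end CharZero

variable (τ : Charge N → TSeries N k) (s : Charge N)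

/-- `ε_{βγ}(s) τ(s - e_β + e_γ, t + [z⁻¹]_γ) z ^ (δ_{βγ} - 1)`, the factor of the adjoint wave
function that corresponds to `waveNum`. -/
noncomputable def dualNum (β γ : Fin N) : TZSeries N k :=
  eps β γ s • (MvPowerSeries.C (zpow k (delta β γ - 1)) * shiftT 1 γ (τ (s.shift γ β)))

theorem zpow_mul_zpow (m n : ℤ) : zpow k m * zpow k n = zpow k (m + n) := by
  rw [zpow, zpow, zpow, HahnSeries.single_mul_single, mul_one, neg_add]

variable {τ s} in
theorem IsTau.bilinear [CharZero k] (hτ : IsTau τ) (α β : Fin N) :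
    Bilinear (waveNum τ s α) (dualNum τ s β) := by
  unfold Bilinear
  rw [← hτ α β s s]
  refine Finset.sum_congr rfl fun γ _ => ?_
  rw [← zCoeff_zsmul]
  congr 1
  have e : s.1 γ - s.1 γ + delta α γ + delta β γ - 2 = (delta α γ - 1) + (delta β γ - 1) := by
    ring
  rw [waveNum, dualNum, inT, inT', e, ← zpow_mul_zpow]
  simp only [map_mul, map_intCast, MvPowerSeries.rename_C, zsmul_eq_mul, Int.cast_mul]
  simp only [expDiff, inT, inT']
  ring

theorem Charge.shift_self (s : Charge N) (α : Fin N) : s.shift α α = s :=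
  Subtype.ext (by simp [Charge.shift])

theorem delta_sub_one_nonpos (α β : Fin N) : delta α β - 1 ≤ 0 := by
  unfold delta; split_ifs <;> norm_num

/-- The term of degree zero in `z` of `f(t + c [z⁻¹]_γ)` is `f(t)`. -/
theorem zCoeff_zero_shiftT (c : k) (γ : Fin N) (f : TSeries N k) :
    zCoeff 0 (shiftT c γ f) = f := by
  refine MvPowerSeries.ext fun m => ?_
  have h1 : MvPowerSeries.coeff m (zCoeff 0 (shiftT c γ f)) =
      MvPowerSeries.coeff (Finsupp.optionElim 0 m) (f.subst (shiftArg c γ)) := by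
    rw [coeff_zCoeff]
    change (HahnSeries.ofPowerSeries ℤ k _).coeff _ = _
    rw [PowerSeries.coeff_coe, if_neg (by omega)]
    simp
  have h2 : Finsupp.optionElim 0 m = Finsupp.embDomain Function.Embedding.some m := by
    ext a
    cases a with
    | none => rw [Finsupp.optionElim_apply_none, Finsupp.embDomain_of_notMem_range]; simp
    | some x =>
      rw [Finsupp.optionElim_apply_some]
      exact (Finsupp.embDomain_apply_self Function.Embedding.some m x).symm
  have h3 : ∀ i : TimeIdx N, MvPowerSeries.killCompl Function.Embedding.some (shiftArg c γ i) =
      MvPowerSeries.X i := by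
    intro i
    have e1 : MvPowerSeries.killCompl (R := k) Function.Embedding.some
        (MvPowerSeries.X (some i)) = MvPowerSeries.X i :=
      MvPowerSeries.killCompl_X (e := Function.Embedding.some) i
    have e2 : MvPowerSeries.killCompl (R := k) (Function.Embedding.some : TimeIdx N ↪ _)
        (MvPowerSeries.X none) = 0 := MvPowerSeries.killCompl_X_eq_zero (by simp)
    rw [shiftArg, map_add, e1]
    split_ifs
    · rw [map_mul, map_pow, e2, zero_pow i.2.ne_zero, mul_zero, add_zero]
    · rw [map_zero, add_zero]
  rw [h1, MvPowerSeries.coeff_subst (hasSubst_shiftArg c γ), finsum_eq_single _ m]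
  · rw [h2, ← MvPowerSeries.coeff_killCompl, map_finsuppProd]
    simp only [map_pow, h3]
    rw [← MvPowerSeries.monomial_one_eq, MvPowerSeries.coeff_monomial_same, smul_eq_mul, mul_one]
  · intro d hd
    classical
    rw [h2, ← MvPowerSeries.coeff_killCompl, map_finsuppProd]
    simp only [map_pow, h3]
    rw [← MvPowerSeries.monomial_one_eq, MvPowerSeries.coeff_monomial_ne hd.symm, smul_zero]

theorem zCoeff_shiftT_zero_ite {c : k} (α β : Fin N) (f : TSeries N k) (e : ℤ)
    (he : α = β → e = 1) :
    zCoeff 0 (e • (MvPowerSeries.C (zpow k (delta α β - 1)) * shiftT c β f)) =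
      if α = β then f else 0 := by
  rw [zCoeff_zsmul, zCoeff_C_zpow_mul]
  by_cases h : α = β
  · rw [if_pos h, he h, one_zsmul, delta, if_pos h, sub_self, sub_self, zCoeff_zero_shiftT]
  · have h1 := zCoeff_shiftT_of_pos c β f (n := 1) one_pos 1 0 le_rfl
    rw [one_zsmul, zCoeff_C_zpow_mul] at h1
    rw [if_neg h, delta, if_neg h, show (0 : ℤ) - (0 - 1) = 1 - 0 by norm_num, h1, smul_zero]

theorem eps_of_eq {α β : Fin N} (h : α = β) : eps α β s = 1 := by
  rw [eps, if_neg (by rw [h]; exact lt_irrefl _), if_pos h]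

theorem zCoeff_zero_waveNum (α β : Fin N) :
    zCoeff 0 (waveNum τ s α β) = if α = β then τ s else 0 := by
  rw [waveNum, zCoeff_shiftT_zero_ite α β _ _ (eps_of_eq s)]
  refine ite_congr rfl (fun h => ?_) fun _ => rfl
  rw [h, Charge.shift_self]

theorem zCoeff_zero_dualNum (β γ : Fin N) :
    zCoeff 0 (dualNum τ s β γ) = if β = γ then τ s else 0 := by
  rw [dualNum, zCoeff_shiftT_zero_ite β γ _ _ (eps_of_eq s)]
  refine ite_congr rfl (fun h => ?_) fun _ => rfl
  rw [h, Charge.shift_self]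

theorem zCoeff_waveNum_of_pos {n : ℤ} (hn : 0 < n) (α β : Fin N) :
    zCoeff n (waveNum τ s α β) = 0 :=
  zCoeff_shiftT_of_pos _ _ _ hn _ _ (delta_sub_one_nonpos α β)

theorem zCoeff_dualNum_of_pos {n : ℤ} (hn : 0 < n) (β γ : Fin N) :
    zCoeff n (dualNum τ s β γ) = 0 :=
  zCoeff_shiftT_of_pos _ _ _ hn _ _ (delta_sub_one_nonpos β γ)

end Bilinear

/-! ### Expansions in powers of `z` -/

section Expansions

variable {N : ℕ} {k : Type*} [Field k]

local notation "𝓛" => LaurentSeries k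
local notation "ι" => algebraMap (TSeries N k) (TField N k)
local notation "ιz" => algebraMap (TZSeries N k) (TZField N k)

theorem incl_algebraMap (f : TSeries N k) :
    incl N k (ι f) = ιz (MvPowerSeries.map (HahnSeries.C : k →+* 𝓛) f) := by
  unfold incl IsFractionRing.map
  rw [IsLocalization.map_eq]

/-- The function `f`, a quotient `g / d` with a denominator `d` that does not depend on `z`, has
the expansion `∑ p_n z ^ n`. -/
def HasExpansion (f : TZField N k) (p : ℤ → TField N k) : Prop :=
  ∃ (g : TZSeries N k) (d : TSeries N k), d ≠ 0 ∧ f * incl N k (ι d) = ιz g ∧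
    ∀ n, p n * ι d = ι (zCoeff n g)

theorem algebraMap_ne_zero {d : TSeries N k} (hd : d ≠ 0) : ι d ≠ 0 :=
  fun h => hd (IsFractionRing.injective _ (TField N k) (h.trans (map_zero _).symm))

theorem incl_algebraMap_ne_zero {d : TSeries N k} (hd : d ≠ 0) : incl N k (ι d) ≠ 0 :=
  fun h => algebraMap_ne_zero hd ((incl N k).injective (h.trans (map_zero _).symm))

/-- A function is determined by its expansion. -/
theorem HasExpansion.unique {f f' : TZField N k} {p : ℤ → TField N k} (h : HasExpansion f p)
    (h' : HasExpansion f' p) : f = f' := by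
  obtain ⟨g, d, hd, hf, hp⟩ := h
  obtain ⟨g', d', hd', hf', hp'⟩ := h'
  have h1 : MvPowerSeries.map (HahnSeries.C : k →+* 𝓛) d' * g -
      MvPowerSeries.map (HahnSeries.C : k →+* 𝓛) d * g' = 0 := by
    refine eq_zero_of_zCoeff fun n => IsFractionRing.injective _ (TField N k) ?_
    rw [← coe_zCoeffHom, map_sub, coe_zCoeffHom, zCoeff_map_C_mul, zCoeff_map_C_mul, map_sub,
      map_mul, map_mul, ← hp, ← hp', map_zero]
    ring
  have h2 := congrArg ιz h1
  rw [map_sub, map_mul, map_mul, ← incl_algebraMap, ← incl_algebraMap, ← hf, ← hf', map_zero] at h2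
  have h3 : (f - f') * (incl N k (ι d) * incl N k (ι d')) = 0 := by linear_combination h2
  exact sub_eq_zero.mp ((mul_eq_zero.mp h3).resolve_right
    (mul_ne_zero (incl_algebraMap_ne_zero hd) (incl_algebraMap_ne_zero hd')))

theorem HasExpansion.add {f f' : TZField N k} {p p' : ℤ → TField N k} (h : HasExpansion f p)
    (h' : HasExpansion f' p') : HasExpansion (f + f') (fun n => p n + p' n) := by
  obtain ⟨g, d, hd, hf, hp⟩ := h
  obtain ⟨g', d', hd', hf', hp'⟩ := h'
  refine ⟨MvPowerSeries.map (HahnSeries.C : k →+* 𝓛) d' * g +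
      MvPowerSeries.map (HahnSeries.C : k →+* 𝓛) d * g', d * d', mul_ne_zero hd hd', ?_,
      fun n => ?_⟩
  · simp only [map_add, map_mul, ← incl_algebraMap, ← hf, ← hf']
    ring
  · simp only [zCoeff_add, zCoeff_map_C_mul, map_add, map_mul, ← hp, ← hp']
    ring

theorem HasExpansion.mul_left {f : TZField N k} {p : ℤ → TField N k} (h : HasExpansion f p)
    (c : TField N k) : HasExpansion (incl N k c * f) (fun n => c * p n) := by
  obtain ⟨g, d, hd, hf, hp⟩ := h
  obtain ⟨a, b, hb, rfl⟩ := IsFractionRing.div_surjective (A := TSeries N k) c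
  have hb0 := nonZeroDivisors.ne_zero hb
  have hb1 := algebraMap_ne_zero hb0
  have hb2 := incl_algebraMap_ne_zero hb0
  refine ⟨MvPowerSeries.map (HahnSeries.C : k →+* 𝓛) a * g, b * d, mul_ne_zero hb0 hd, ?_,
    fun n => ?_⟩
  · simp only [map_mul, ← incl_algebraMap, ← hf, map_div₀]
    field_simp
  · simp only [zCoeff_map_C_mul, map_mul, ← hp]
    field_simp

theorem HasExpansion.zpow_mul {f : TZField N k} {p : ℤ → TField N k} (h : HasExpansion f p)
    (j : ℤ) :
    HasExpansion (ιz (MvPowerSeries.C (zpow k j)) * f) (fun n => p (n - j)) := by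
  obtain ⟨g, d, hd, hf, hp⟩ := h
  refine ⟨MvPowerSeries.C (zpow k j) * g, d, hd, ?_, fun n => ?_⟩
  · rw [map_mul, ← hf, mul_assoc]
  · rw [zCoeff_C_zpow_mul, hp]

theorem HasExpansion.zero : HasExpansion (0 : TZField N k) (fun _ => 0) :=
  ⟨0, 1, one_ne_zero, by simp, fun n => by rw [zCoeff_zero]; simp⟩

theorem HasExpansion.sum {κ : Type*} {t : Finset κ} {f : κ → TZField N k}
    {p : κ → ℤ → TField N k} (h : ∀ c ∈ t, HasExpansion (f c) (p c)) :
    HasExpansion (∑ c ∈ t, f c) (fun n => ∑ c ∈ t, p c n) := by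
  classical
  induction t using Finset.induction_on with
  | empty => simpa using HasExpansion.zero
  | insert c t hc ih =>
    simp only [Finset.sum_insert hc]
    exact (h c (Finset.mem_insert_self c t)).add
      (ih fun c' hc' => h c' (Finset.mem_insert_of_mem hc'))

theorem HasExpansion.tDeriv {f : TZField N k} {p : ℤ → TField N k} (h : HasExpansion f p)
    (i : TimeIdx N) : HasExpansion (tDeriv i f) (fun n => tDeriv i (p n)) := by
  obtain ⟨g, d, hd, hf, hp⟩ := h
  have hf' := congrArg (MultiKP.tDeriv i) hf
  rw [tDeriv_mul, incl_algebraMap, tDeriv_algebraMap, tDeriv_algebraMap, pderiv_map_C,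
    ← incl_algebraMap, ← incl_algebraMap] at hf'
  refine ⟨MvPowerSeries.map (HahnSeries.C : k →+* 𝓛) d * MvPowerSeries.pderiv 𝓛 i g -
      MvPowerSeries.map (HahnSeries.C : k →+* 𝓛) (MvPowerSeries.pderiv k i d) * g, d * d,
      mul_ne_zero hd hd, ?_, fun n => ?_⟩
  · simp only [map_sub, map_mul, ← incl_algebraMap, ← hf, ← hf']
    ring
  · have hp' := congrArg (MultiKP.tDeriv i) (hp n)
    rw [tDeriv_mul, tDeriv_algebraMap, tDeriv_algebraMap] at hp'
    rw [← coe_zCoeffHom, map_sub, coe_zCoeffHom, zCoeff_map_C_mul, zCoeff_map_C_mul,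
      zCoeff_pderiv]
    simp only [map_sub, map_mul, ← hp, ← hp']
    ring

theorem hasExpansion_algebraMap (g : TZSeries N k) :
    HasExpansion (ιz g) (fun n => ι (zCoeff n g)) :=
  ⟨g, 1, one_ne_zero, by simp, fun n => by simp⟩

theorem HasExpansion.eq_zCoeff {g : TZSeries N k} {p : ℤ → TField N k}
    (h : HasExpansion (ιz g) p) (n : ℤ) : p n = ι (zCoeff n g) := by
  obtain ⟨g', d, hd, hf, hp⟩ := h
  rw [incl_algebraMap, ← map_mul] at hf
  have h1 := IsFractionRing.injective _ (TZField N k) hf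
  have h2 := hp n
  rw [← h1, mul_comm g, zCoeff_map_C_mul, map_mul, mul_comm (ι d)] at h2
  exact mul_right_cancel₀ (algebraMap_ne_zero hd) h2

end Expansions

/-! ### Symbols -/

section Symbols

variable {N : ℕ} {k : Type*} [Field k]

local notation "𝓛" => LaurentSeries k
local notation "ι" => algebraMap (TSeries N k) (TField N k)
local notation "ιz" => algebraMap (TZSeries N k) (TZField N k)
local notation "𝓜" => Matrix (Fin N) (Fin N) (TField N k)
local notation "𝓜z" => Matrix (Fin N) (Fin N) (TZField N k)

open PDO

/-- The operator `∂X/∂t_i + X E_α ∂ ^ j` for `i = (α, j)`; it is the composition of `∂/∂t_i`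
and `X`, applied to functions of the form `diag(e ^ ξ(t_β, z))`. -/
noncomputable def covPDO (i : TimeIdx N) (X : PDO N k) : PDO N k :=
  X.timeDeriv i + X * unitDel N k i.1 i.2

theorem coeff_covPDO (i : TimeIdx N) (X : PDO N k) (n : ℤ) :
    (covPDO i X).coeff n =
      matTDeriv i (X.coeff n) + X.coeff (n - (i.2 : ℕ)) * Matrix.single i.1 i.1 1 := by
  rw [covPDO, coeff_add, unitDel, coeff_mul_monomial_of_const _ _ (matDel_single_one _ _)]
  rfl

theorem sum_covPDO (X : PDO N k) : ∑ κ : Fin N, covPDO (κ, 1) X = del * X := by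
  refine PDO.ext (funext fun n => ?_)
  rw [coeff_sum, coeff_del_mul]
  simp only [coeff_covPDO, PNat.one_coe, Nat.cast_one]
  rw [Finset.sum_add_distrib, ← Finset.mul_sum, Matrix.sum_single_one, mul_one, add_comm]
  rfl

theorem covPDO_monomial_mul (i : TimeIdx N) (a : 𝓜) (X : PDO N k) :
    covPDO i (monomial 0 a * X) =
      monomial 0 (matTDeriv i a) * X + monomial 0 a * covPDO i X := by
  refine PDO.ext (funext fun n => ?_)
  simp only [coeff_covPDO, coeff_add, coeff_monomial_zero_mul, matTDeriv_mul, mul_add, mul_assoc,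
    add_assoc]

/-- The derivative `u ↦ (∂/∂t_i (u e)) e⁻¹`, where `e = diag(e ^ ξ(t_β, z))`. -/
noncomputable def covMat (i : TimeIdx N) (u : 𝓜z) : 𝓜z :=
  matTDeriv i u + Matrix.of fun a b =>
    ιz (if i.1 = b then MvPowerSeries.C (zpow k (i.2 : ℕ)) else 0) * u a b

/-- The derivative `u ↦ (∂ (u e)) e⁻¹`, where `e = diag(e ^ ξ(t_β, z))`. -/
noncomputable def covDel (u : 𝓜z) : 𝓜z := ∑ κ : Fin N, covMat (κ, 1) u

/-- `u` is the symbol of the operator `X`, that is `u = ∑ a_n z ^ n` for `X = ∑ a_n ∂ ^ n`. Thus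
`X e = u e` for `e = diag(e ^ ξ(t_β, z))`, since `∂ ^ n e = z ^ n e`. -/
def HasSymbol (X : PDO N k) (u : 𝓜z) : Prop :=
  ∀ a b, HasExpansion (u a b) (fun n => X.coeff n a b)

theorem HasSymbol.unique {X : PDO N k} {u v : 𝓜z} (h : HasSymbol X u) (h' : HasSymbol X v) :
    u = v := by
  ext a b
  exact (h a b).unique (h' a b)

theorem HasSymbol.sum {κ : Type*} {t : Finset κ} {X : κ → PDO N k} {u : κ → 𝓜z}
    (h : ∀ c ∈ t, HasSymbol (X c) (u c)) : HasSymbol (∑ c ∈ t, X c) (∑ c ∈ t, u c) := by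
  intro a b
  simp only [coeff_sum, Matrix.sum_apply]
  exact HasExpansion.sum fun c hc => h c hc a b

theorem HasSymbol.mul_left {X : PDO N k} {u : 𝓜z} (h : HasSymbol X u) (a : 𝓜) :
    HasSymbol (monomial 0 a * X) (a.map (incl N k) * u) := by
  intro b c
  simp only [coeff_monomial_zero_mul, Matrix.mul_apply, Matrix.map_apply]
  exact HasExpansion.sum fun d _ => (h d c).mul_left _

theorem HasSymbol.cov {X : PDO N k} {u : 𝓜z} (h : HasSymbol X u) (i : TimeIdx N) :
    HasSymbol (covPDO i X) (covMat i u) := by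
  intro a b
  simp only [coeff_covPDO, Matrix.add_apply, covMat, Matrix.of_apply]
  refine ((h a b).tDeriv i).add ?_
  by_cases hb : i.1 = b
  · subst hb
    simpa using (h a i.1).zpow_mul (i.2 : ℕ)
  · simp only [if_neg hb, map_zero, zero_mul]
    have : ∀ n : ℤ, (X.coeff n * Matrix.single i.1 i.1 (1 : TField N k)) a b = 0 := fun n => by
      rw [Matrix.mul_single_apply_of_ne _ _ _ _ _ (Ne.symm hb)]
    simp only [this]
    exact HasExpansion.zero

theorem HasSymbol.del_mul {X : PDO N k} {u : 𝓜z} (h : HasSymbol X u) :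
    HasSymbol (del * X) (covDel u) := by
  rw [← sum_covPDO]
  exact HasSymbol.sum fun κ _ => h.cov (κ, 1)

theorem HasSymbol.del_pow_mul {X : PDO N k} {u : 𝓜z} (h : HasSymbol X u) (n : ℕ) :
    HasSymbol (del ^ n * X) (covDel^[n] u) := by
  induction n with
  | zero => simpa using h
  | succ n ih =>
    rw [pow_succ', mul_assoc, Function.iterate_succ_apply']
    exact ih.del_mul

/-! ### Differential operators -/

/-- `L` contains no negative power of `∂`. -/
def PDO.IsDiffOp (L : PDO N k) : Prop := ∀ n, n < 0 → L.coeff n = 0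

theorem PDO.IsDiffOp.mul {L L' : PDO N k} (h : L.IsDiffOp) (h' : L'.IsDiffOp) :
    (L * L').IsDiffOp := by
  refine fun n hn => finsum_eq_zero_of_forall_eq_zero ?_
  rintro ⟨m, i⟩
  simp only
  by_cases hm : m < 0
  · rw [h m hm, zero_mul, zsmul_zero]
  by_cases hi : n - m + i < 0
  · rw [h' _ hi, iterate_matDel_zero, mul_zero, zsmul_zero]
  · obtain ⟨m, rfl⟩ := Int.eq_ofNat_of_zero_le (not_lt.mp hm)
    have h1 : Ring.choose (m : ℤ) i = 0 := by
      have := Ring.choose_natCast (R := ℤ) m i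
      rw [Nat.choose_eq_zero_of_lt (by omega), Nat.cast_zero] at this
      exact this
    rw [zsmul_eq_mul, h1, Int.cast_zero, zero_mul]

theorem PDO.isDiffOp_monomial (n : ℕ) (a : 𝓜) : (monomial n a : PDO N k).IsDiffOp :=
  fun m hm => if_neg (by omega)

theorem PDO.IsDiffOp.eq_sum {L : PDO N k} (h : L.IsDiffOp) {M : ℕ} (hM : L.OrderLE M) :
    L = ∑ n ∈ Finset.range (M + 1), monomial 0 (L.coeff n) * del ^ n := by
  refine PDO.ext (funext fun m => ?_)
  rw [coeff_sum]
  simp only [← monomial_eq_mul_del_pow, coeff_monomial]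
  by_cases hm : m < 0
  · rw [h m hm, Finset.sum_eq_zero]
    exact fun n _ => if_neg (by omega)
  · obtain ⟨m, rfl⟩ := Int.eq_ofNat_of_zero_le (not_lt.mp hm)
    by_cases hm' : m < M + 1
    · rw [Finset.sum_eq_single m]
      · rw [if_pos rfl]
      · exact fun n _ hn => if_neg (by omega)
      · exact fun hn => absurd (Finset.mem_range.mpr hm') hn
    · rw [hM _ (by omega), Finset.sum_eq_zero]
      intro n hn
      rw [Finset.mem_range] at hn
      exact if_neg (by omega)

theorem PDO.exists_nat_orderLE (X : PDO N k) : ∃ M : ℕ, X.OrderLE M := by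
  obtain ⟨M, hM⟩ := X.bdd
  exact ⟨M.toNat, fun n hn => hM n (by omega)⟩

theorem PDO.coeff_posPart (X : PDO N k) (n : ℤ) :
    X.posPart.coeff n = if 0 ≤ n then X.coeff n else 0 := rfl

theorem PDO.coeff_negPart (X : PDO N k) (n : ℤ) :
    X.negPart.coeff n = if n < 0 then X.coeff n else 0 := rfl

theorem PDO.posPart_add_negPart (X : PDO N k) : X.posPart + X.negPart = X := by
  refine PDO.ext (funext fun n => ?_)
  rw [coeff_add, coeff_posPart, coeff_negPart]
  by_cases h : 0 ≤ n
  · rw [if_pos h, if_neg (not_lt.mpr h), add_zero]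
  · rw [if_neg h, if_pos (not_le.mp h), zero_add]

theorem PDO.isDiffOp_posPart (X : PDO N k) : X.posPart.IsDiffOp :=
  fun _ hn => if_neg (not_le.mpr hn)

theorem PDO.orderLE_negPart (X : PDO N k) : X.negPart.OrderLE (-1) :=
  fun _ hn => if_neg (by omega)

/-! ### The residue pairing -/

/-- The residue `Res_z X(z) b(z)` of the symbol of `X` times `b(z) = ∑ b_m z ^ m`. The sum is finite
if `b_m = 0` for `m > 0`. -/
noncomputable def resPairing (b : ℤ → 𝓜) (X : PDO N k) : 𝓜 :=
  ∑ᶠ m : ℤ, X.coeff m * b (-1 - m)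

theorem resPairing_eq_sum {b : ℤ → 𝓜} (hb : ∀ m, 0 < m → b m = 0) {X : PDO N k} {M : ℤ}
    (hX : X.OrderLE M) :
    resPairing b X = ∑ m ∈ Finset.Icc (-1) M, X.coeff m * b (-1 - m) := by
  refine finsum_eq_sum_of_support_subset _ fun m hm => ?_
  by_contra hc
  simp only [Finset.coe_Icc, Set.mem_Icc, not_and_or, not_le] at hc
  refine hm ?_
  rcases hc with hc | hc
  · simp only [hb _ (show 0 < -1 - m by omega), mul_zero]
  · simp only [hX m hc, zero_mul]

theorem resPairing_add {b : ℤ → 𝓜} (hb : ∀ m, 0 < m → b m = 0) (X Y : PDO N k) :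
    resPairing b (X + Y) = resPairing b X + resPairing b Y := by
  obtain ⟨M, hM⟩ := X.exists_nat_orderLE
  obtain ⟨M', hM'⟩ := Y.exists_nat_orderLE
  have h1 := hM.mono (le_max_left (M : ℤ) M')
  have h2 := hM'.mono (le_max_right (M : ℤ) M')
  rw [resPairing_eq_sum hb h1, resPairing_eq_sum hb h2, resPairing_eq_sum hb (h1.add h2),
    ← Finset.sum_add_distrib]
  exact Finset.sum_congr rfl fun m _ => by rw [coeff_add, add_mul]

theorem resPairing_monomial_mul {b : ℤ → 𝓜} (hb : ∀ m, 0 < m → b m = 0) (a : 𝓜)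
    (X : PDO N k) : resPairing b (monomial 0 a * X) = a * resPairing b X := by
  obtain ⟨M, hM⟩ := X.exists_nat_orderLE
  have h := (orderLE_monomial 0 a).mul hM
  rw [zero_add] at h
  rw [resPairing_eq_sum hb hM, resPairing_eq_sum hb h, Finset.mul_sum]
  exact Finset.sum_congr rfl fun m _ => by rw [coeff_monomial_zero_mul, mul_assoc]

/-- All the operators `∂ ^ n X`, `n ≥ 0`, pair to zero with `b`. -/
def IsOrthogonal (b : ℤ → 𝓜) (X : PDO N k) : Prop := ∀ n : ℕ, resPairing b ((del : PDO N k) ^ n * X) = 0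

theorem IsOrthogonal.resPairing_mul {b : ℤ → 𝓜} (hb : ∀ m, 0 < m → b m = 0) {X : PDO N k}
    (hX : IsOrthogonal b X) {L : PDO N k} (hL : L.IsDiffOp) : resPairing b (L * X) = 0 := by
  obtain ⟨M, hM⟩ := L.exists_nat_orderLE
  rw [hL.eq_sum hM, Finset.sum_mul]
  have h := map_sum (AddMonoidHom.mk' (resPairing b) (resPairing_add hb))
    (fun n : ℕ => monomial 0 (L.coeff n) * del ^ n * X) (Finset.range (M + 1))
  simp only [AddMonoidHom.mk'_apply] at h
  rw [h]
  refine Finset.sum_eq_zero fun n _ => ?_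
  rw [mul_assoc, resPairing_monomial_mul hb, hX n, mul_zero]

/-- The operators orthogonal to `b` form a left module over the differential operators. -/
theorem IsOrthogonal.mul_left {b : ℤ → 𝓜} (hb : ∀ m, 0 < m → b m = 0) {X : PDO N k}
    (hX : IsOrthogonal b X) {L : PDO N k} (hL : L.IsDiffOp) : IsOrthogonal b (L * X) := by
  intro n
  rw [← mul_assoc]
  refine hX.resPairing_mul hb (IsDiffOp.mul ?_ hL)
  rw [del_pow]
  exact isDiffOp_monomial n 1

theorem IsOrthogonal.add {b : ℤ → 𝓜} (hb : ∀ m, 0 < m → b m = 0) {X Y : PDO N k}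
    (hX : IsOrthogonal b X) (hY : IsOrthogonal b Y) : IsOrthogonal b (X + Y) := by
  intro n
  rw [mul_add, resPairing_add hb, hX n, hY n, add_zero]

/-- An operator of negative order that is orthogonal to `b = b_0 + b_{-1} z⁻¹ + …` with `b_0`
invertible vanishes: if its leading term is `a ∂ ^ (-n - 1)`, then `∂ ^ n X = a ∂ ⁻¹ + …` pairs to
`a b_0`. -/
theorem IsOrthogonal.eq_zero {b : ℤ → 𝓜} (hb : ∀ m, 0 < m → b m = 0) (hb0 : IsUnit (b 0))
    {X : PDO N k} (hX : IsOrthogonal b X) (hneg : X.OrderLE (-1)) : X = 0 := by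
  have h : ∀ n : ℕ, X.OrderLE (-1 - n) := by
    intro n
    induction n with
    | zero => simpa using hneg
    | succ n ih =>
      have h1 : X.coeff (-1 - n) = 0 := by
        have h2 := coeff_mul_top (orderLE_del_pow n) ih
        have h3 := (orderLE_del_pow n).mul ih
        rw [show (n : ℤ) + (-1 - n) = -1 by ring] at h2 h3
        have h4 := hX n
        rw [resPairing_eq_sum hb h3, Finset.Icc_self, Finset.sum_singleton, h2, sub_self, del_pow,
          coeff_monomial, if_pos rfl, one_mul] at h4
        exact hb0.mul_left_eq_zero.mp h4
      intro m hm
      by_cases hm' : m = -1 - n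
      · rw [hm', h1]
      · exact ih m (by push_cast at hm; omega)
  refine PDO.ext (funext fun m => ?_)
  exact h (-m).toNat m (by omega)

end Symbols

/-! ### Operators annihilated by the dual wave function -/

section Wave

variable {N : ℕ} {k : Type*} [Field k] (τ : Charge N → TSeries N k) (s : Charge N)

local notation "𝓛" => LaurentSeries k
local notation "ι" => algebraMap (TSeries N k) (TField N k)
local notation "ιz" => algebraMap (TZSeries N k) (TZField N k)
local notation "𝓜" => Matrix (Fin N) (Fin N) (TField N k)
local notation "𝓜z" => Matrix (Fin N) (Fin N) (TZField N k)

open PDO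

/-- The coefficients of the powers of `z` in the transpose of `dualNum`. -/
noncomputable def dualCoeff (m : ℤ) : 𝓜 :=
  Matrix.of fun γ β => ι (zCoeff m (dualNum τ s β γ))

theorem dualCoeff_of_pos (m : ℤ) (hm : 0 < m) : dualCoeff τ s m = 0 := by
  ext γ β
  rw [dualCoeff, Matrix.of_apply, zCoeff_dualNum_of_pos τ s hm, map_zero, Matrix.zero_apply]

theorem dualCoeff_zero : dualCoeff τ s 0 = ι (τ s) • 1 := by
  ext γ β
  rw [dualCoeff, Matrix.of_apply, zCoeff_zero_dualNum, Matrix.smul_apply, Matrix.one_apply]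
  by_cases h : γ = β
  · simp [h]
  · simp [h, Ne.symm h]

/-- The operator with the symbol `waveNum`. -/
noncomputable def numOp : PDO N k where
  coeff n := Matrix.of fun α β => ι (zCoeff n (waveNum τ s α β))
  bdd := ⟨0, fun n hn => by
    ext α β
    rw [Matrix.of_apply, zCoeff_waveNum_of_pos τ s hn, map_zero, Matrix.zero_apply]⟩

theorem dressHat_eq : dressHat τ s = monomial 0 ((ι (τ s))⁻¹ • 1) * numOp τ s := by
  refine PDO.ext (funext fun n => ?_)
  rw [coeff_monomial_zero_mul, smul_mul_assoc, one_mul]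
  ext α β
  rw [Matrix.smul_apply, smul_eq_mul, mul_comm, ← div_eq_mul_inv]
  rfl

theorem orderLE_dressHat : (dressHat τ s).OrderLE 0 := by
  intro n hn
  rw [dressHat_eq, coeff_monomial_zero_mul]
  ext α β
  have h : (numOp τ s).coeff n = 0 := by
    ext α β
    exact (congrArg ι (zCoeff_waveNum_of_pos τ s hn α β)).trans (map_zero _)
  rw [h, mul_zero]

theorem coeff_zero_dressHat (hs : τ s ≠ 0) : (dressHat τ s).coeff 0 = 1 := by
  ext α β
  change ι (zCoeff 0 (waveNum τ s α β)) / ι (τ s) = _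
  rw [zCoeff_zero_waveNum, Matrix.one_apply]
  split_ifs
  · exact div_self (algebraMap_ne_zero hs)
  · rw [map_zero, zero_div]

variable [CharZero k]

/-- `X` has a symbol with entries in the power series whose rows satisfy the bilinear identity
with the dual wave function. -/
def IsBilinear (X : PDO N k) : Prop :=
  ∃ p : Matrix (Fin N) (Fin N) (TZSeries N k), HasSymbol X (p.map ιz) ∧
    ∀ α β, Bilinear (p α) (dualNum τ s β)

variable {τ s}

theorem IsBilinear.cov {X : PDO N k} (h : IsBilinear τ s X) (i : TimeIdx N) :
    IsBilinear τ s (covPDO i X) := by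
  obtain ⟨p, hp, hB⟩ := h
  refine ⟨Matrix.of fun a b => covSeries i b (p a b), ?_, fun α β => (hB α β).covSeries i⟩
  have h1 : (Matrix.of fun a b => covSeries i b (p a b)).map ιz = covMat i (p.map ιz) := by
    ext a b
    rw [Matrix.map_apply, Matrix.of_apply, covSeries, map_add, map_mul, ← tDeriv_algebraMap]
    rfl
  rw [h1]
  exact hp.cov i

theorem IsBilinear.sum {κ : Type*} {t : Finset κ} {X : κ → PDO N k}
    (h : ∀ c, IsBilinear τ s (X c)) : IsBilinear τ s (∑ c ∈ t, X c) := by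
  choose p hp hB using h
  refine ⟨∑ c ∈ t, p c, ?_, fun α β => ?_⟩
  · have h1 : (∑ c ∈ t, p c).map ιz = ∑ c ∈ t, (p c).map ιz := by
      ext a b
      simp only [Matrix.map_apply, Matrix.sum_apply, map_sum]
    rw [h1]
    exact HasSymbol.sum fun c _ => hp c
  · have h2 := Bilinear.sum (t := t) (p := fun c => p c α) fun c _ => hB c α β
    convert h2 using 2 with γ
    rw [Matrix.sum_apply]

theorem IsBilinear.del_mul {X : PDO N k} (h : IsBilinear τ s X) : IsBilinear τ s (del * X) := by
  rw [← sum_covPDO]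
  exact IsBilinear.sum fun κ => h.cov (κ, 1)

theorem IsBilinear.resPairing_eq_zero {X : PDO N k} (h : IsBilinear τ s X) :
    resPairing (dualCoeff τ s) X = 0 := by
  obtain ⟨p, hp, hB⟩ := h
  have hX : ∀ n a b, X.coeff n a b = ι (zCoeff n (p a b)) := fun n a b => (hp a b).eq_zCoeff n
  obtain ⟨M, hM⟩ := X.exists_nat_orderLE
  have hpM : ∀ a b, ∀ m : ℤ, (M : ℤ) < m → zCoeff m (p a b) = 0 := by
    intro a b m hm
    refine IsFractionRing.injective _ (TField N k) ?_
    rw [← hX, hM m hm, map_zero, Matrix.zero_apply]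
  rw [resPairing_eq_sum (dualCoeff_of_pos τ s) hM]
  ext α β
  have h1 := congrArg ι (hB α β).sum_zCoeff_mul
  have h2 : ∀ γ, zCoeff (-1) (p α γ * dualNum τ s β γ) = ∑ m ∈ Finset.Icc (-1) (M : ℤ),
      zCoeff m (p α γ) * zCoeff (-1 - m) (dualNum τ s β γ) := fun γ => by
    rw [zCoeff_mul (hpM α γ) fun m hm => zCoeff_dualNum_of_pos τ s hm β γ, sub_zero]
  simp only [h2, map_sum, map_mul, map_zero] at h1
  rw [Matrix.sum_apply, Matrix.zero_apply, ← h1, Finset.sum_comm]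
  refine Finset.sum_congr rfl fun m _ => ?_
  rw [Matrix.mul_apply]
  exact Finset.sum_congr rfl fun γ _ => by rw [hX]; rfl

theorem IsBilinear.isOrthogonal {X : PDO N k} (h : IsBilinear τ s X) :
    IsOrthogonal (dualCoeff τ s) X := by
  have h1 : ∀ n : ℕ, IsBilinear τ s (del ^ n * X) := by
    intro n
    induction n with
    | zero => simpa using h
    | succ n ih =>
      rw [pow_succ', mul_assoc]
      exact ih.del_mul
  exact fun n => (h1 n).resPairing_eq_zero

variable (τ s)

theorem isBilinear_numOp (hτ : IsTau τ) : IsBilinear τ s (numOp τ s) :=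
  ⟨Matrix.of (waveNum τ s), fun a b => hasExpansion_algebraMap (waveNum τ s a b),
    fun α β => hτ.bilinear α β⟩

theorem isOrthogonal_dressHat (hτ : IsTau τ) : IsOrthogonal (dualCoeff τ s) (dressHat τ s) := by
  rw [dressHat_eq]
  exact (isBilinear_numOp τ s hτ).isOrthogonal.mul_left (dualCoeff_of_pos τ s)
    (isDiffOp_monomial 0 _)

theorem isOrthogonal_covPDO_dressHat (hτ : IsTau τ) (i : TimeIdx N) :
    IsOrthogonal (dualCoeff τ s) (covPDO i (dressHat τ s)) := by
  rw [dressHat_eq, covPDO_monomial_mul]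
  exact ((isBilinear_numOp τ s hτ).isOrthogonal.mul_left (dualCoeff_of_pos τ s)
    (isDiffOp_monomial 0 _)).add (dualCoeff_of_pos τ s)
    (((isBilinear_numOp τ s hτ).cov i).isOrthogonal.mul_left (dualCoeff_of_pos τ s)
    (isDiffOp_monomial 0 _))

variable {τ s}

/-- `(∂Ŵ/∂t_i + Ŵ E_α ∂ ^ j) Ŵ⁻¹` is a differential operator. -/
theorem negPart_covPDO_mul_inv (hτ : IsTau τ) (hs : τ s ≠ 0) (i : TimeIdx N) {V : PDO N k}
    (hV : IsInverse (dressHat τ s) V) : (covPDO i (dressHat τ s) * V).negPart = 0 := by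
  set X := covPDO i (dressHat τ s) with hX
  have h1 : (X * V).negPart * dressHat τ s = X + -(X * V).posPart * dressHat τ s := by
    have h2 : (X * V).negPart = X * V + -(X * V).posPart :=
      eq_add_neg_of_add_eq (by rw [add_comm, PDO.posPart_add_negPart])
    rw [h2, add_mul, mul_assoc, hV.2, mul_one]
  have h3 : IsOrthogonal (dualCoeff τ s) ((X * V).negPart * dressHat τ s) := by
    rw [h1]
    refine (isOrthogonal_covPDO_dressHat τ s hτ i).add (dualCoeff_of_pos τ s)
      ((isOrthogonal_dressHat τ s hτ).mul_left (dualCoeff_of_pos τ s) fun n hn => ?_)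
    rw [coeff_neg, isDiffOp_posPart _ n hn, neg_zero]
  have h4 := (orderLE_negPart (X * V)).mul (orderLE_dressHat τ s)
  rw [add_zero] at h4
  have hu : IsUnit (dualCoeff τ s 0) := by
    rw [dualCoeff_zero]
    have := algebraMap_ne_zero hs
    exact IsUnit.smul (Units.mk0 _ this) isUnit_one
  have h5 := h3.eq_zero (dualCoeff_of_pos τ s) hu h4
  have h6 := congrArg (· * V) h5
  simpa only [mul_assoc, hV.1, mul_one, zero_mul] using h6

end Wave

/-! ### The operators `diag(∂ ^ {s_1}, …, ∂ ^ {s_N})` -/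

section Dressing

variable {N : ℕ} {k : Type*} [Field k]

open PDO

theorem PDO.diagPow_eq_sum (s : Charge N) :
    diagPow k s = ∑ α, monomial (s.1 α) (Matrix.single α α 1) := by
  refine PDO.ext (funext fun n => ?_)
  rw [coeff_sum]
  ext a b
  simp only [coeff_monomial, Matrix.sum_apply]
  change Matrix.diagonal (fun α => if s.1 α = n then (1 : TField N k) else 0) a b = _
  rw [Matrix.diagonal_apply, Finset.sum_eq_single a]
  · by_cases h : s.1 a = n
    · rw [if_pos h, if_pos h.symm, Matrix.single_apply]
      simp
    · rw [if_neg h, if_neg (Ne.symm h)]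
      simp
  · intro c _ hc
    split_ifs
    · rw [Matrix.single_apply, if_neg (fun h => hc h.1)]
    · rfl
  · exact fun h => absurd (Finset.mem_univ a) h

theorem PDO.diagPow_mul_diagPow (s s' : Charge N) (h : ∀ α, s.1 α + s'.1 α = 0) :
    diagPow k s * diagPow k s' = 1 := by
  rw [diagPow_eq_sum, diagPow_eq_sum, Finset.sum_mul_sum]
  have h1 : ∀ α : Fin N, ∑ β, monomial (s.1 α) (Matrix.single α α 1) *
      monomial (s'.1 β) (Matrix.single β β 1) =
        (monomial 0 (Matrix.single α α 1) : PDO N k) := by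
    intro α
    rw [Finset.sum_eq_single α]
    · rw [monomial_mul_monomial_of_const _ _ _ (matDel_single_one _ _), h,
        Matrix.single_mul_single_same, one_mul]
    · intro β _ hβ
      rw [monomial_mul_monomial_of_const _ _ _ (matDel_single_one _ _),
        Matrix.single_mul_single_of_ne _ _ _ _ (Ne.symm hβ)]
      exact PDO.ext (funext fun n => ite_self 0)
    · exact fun h => absurd (Finset.mem_univ α) h
  simp only [h1]
  refine PDO.ext (funext fun n => ?_)
  rw [coeff_sum, coeff_one]
  simp only [coeff_monomial]
  split_ifs
  · exact Matrix.sum_single_one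
  · exact Finset.sum_const_zero

/-- The charge `-s`. -/
def Charge.neg (s : Charge N) : Charge N := ⟨-s.1, by simp [s.2]⟩

theorem PDO.isInverse_diagPow (s : Charge N) : IsInverse (diagPow k s) (diagPow k s.neg) :=
  ⟨diagPow_mul_diagPow _ _ fun α => add_neg_cancel (s.1 α),
    diagPow_mul_diagPow _ _ fun α => neg_add_cancel (s.1 α)⟩

theorem diagPow_mul_unitDel (s : Charge N) (α : Fin N) (j : ℕ+) :
    diagPow k s * unitDel N k α j = unitDel N k α j * diagPow k s := by
  rw [diagPow_eq_sum, unitDel, Finset.sum_mul, Finset.mul_sum]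
  refine Finset.sum_congr rfl fun β _ => ?_
  rw [monomial_mul_monomial_of_const _ _ _ (matDel_single_one _ _),
    monomial_mul_monomial_of_const _ _ _ (matDel_single_one _ _), add_comm]
  by_cases h : α = β
  · rw [h]
  · rw [Matrix.single_mul_single_of_ne _ _ _ _ h, Matrix.single_mul_single_of_ne _ _ _ _ (Ne.symm h)]

end Dressing

/-! ### The action on the wave function -/

section Action

variable {N : ℕ} {k : Type*} [Field k]

local notation "𝓛" => LaurentSeries k
local notation "ι" => algebraMap (TSeries N k) (TField N k)
local notation "ιz" => algebraMap (TZSeries N k) (TZField N k)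
local notation "𝓜z" => Matrix (Fin N) (Fin N) (TZField N k)

open PDO

/-- The matrix `∑ w_j z ^ (-j)`, the symbol of the dressing operator. -/
noncomputable def dressSymbol (τ : Charge N → TSeries N k) (s : Charge N) : 𝓜z :=
  Matrix.of fun α β => ιz (waveNum τ s α β) / incl N k (ι (τ s))

theorem hasSymbol_dressHat {τ : Charge N → TSeries N k} {s : Charge N} (hs : τ s ≠ 0) :
    HasSymbol (dressHat τ s) (dressSymbol τ s) :=
  fun α β => ⟨waveNum τ s α β, τ s, hs,
    div_mul_cancel₀ (ιz (waveNum τ s α β)) (incl_algebraMap_ne_zero hs),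
    fun n => div_mul_cancel₀ (ι (zCoeff n (waveNum τ s α β))) (algebraMap_ne_zero hs)⟩

variable [CharZero k]

/-- The matrix `diag(z ^ {s_β} e ^ ξ(t_β, z))`. -/
noncomputable def expMat (k : Type*) [Field k] [CharZero k] (s : Charge N) :
    Matrix (Fin N) (Fin N) (TZField N k) :=
  Matrix.diagonal fun β => algebraMap (TZSeries N k) (TZField N k)
    (MvPowerSeries.C (zpow k (s.1 β)) * expSeries (xi k β))

theorem tDeriv_exp (s : Charge N) (β : Fin N) (i : TimeIdx N) :
    tDeriv i (ιz (MvPowerSeries.C (zpow k (s.1 β)) * expSeries (xi k β))) =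
      ιz (if i.1 = β then MvPowerSeries.C (zpow k (i.2 : ℕ)) else 0) *
        ιz (MvPowerSeries.C (zpow k (s.1 β)) * expSeries (xi k β)) := by
  rw [tDeriv_algebraMap, Derivation.leibniz, MvPowerSeries.pderiv_C, smul_zero, add_zero,
    pderiv_expSeries (constantCoeff_xi β), pderiv_xi, ← map_mul]
  congr 1
  rw [smul_eq_mul]
  ring

theorem matTDeriv_mul_expMat (s : Charge N) (i : TimeIdx N) (u : 𝓜z) :
    matTDeriv i (u * expMat k s) = covMat i u * expMat k s := by
  ext a b
  rw [expMat, Matrix.mul_diagonal, matTDeriv, Matrix.map_apply, Matrix.mul_diagonal, tDeriv_mul,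
    tDeriv_exp, covMat, Matrix.add_apply, Matrix.of_apply, matTDeriv, Matrix.map_apply]
  ring

theorem iterate_matDel_mul_expMat (s : Charge N) (n : ℕ) (u : 𝓜z) :
    matDel^[n] (u * expMat k s) = covDel^[n] u * expMat k s := by
  induction n with
  | zero => rfl
  | succ n ih =>
    rw [Function.iterate_succ_apply', Function.iterate_succ_apply', ih, matDel, covDel,
      Finset.sum_mul]
    exact Finset.sum_congr rfl fun κ _ => matTDeriv_mul_expMat s (κ, 1) _

/-- The action of a differential operator `L` on a function `u diag(z ^ {s_β} e ^ ξ(t_β, z))` is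
given by the symbol of the product of `L` and the operator with symbol `u`. -/
theorem HasSymbol.act_mul_expMat {L X : PDO N k} {u v : 𝓜z} (s : Charge N) (hL : L.IsDiffOp)
    (hu : HasSymbol X u) (hv : HasSymbol (L * X) v) :
    L.act (u * expMat k s) = v * expMat k s := by
  obtain ⟨M, hM⟩ := L.exists_nat_orderLE
  have h1 : HasSymbol (L * X) (∑ n ∈ Finset.range (M + 1),
      (L.coeff n).map (incl N k) * covDel^[n] u) := by
    conv => enter [1]; rw [hL.eq_sum hM, Finset.sum_mul]
    refine HasSymbol.sum fun n _ => ?_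
    rw [mul_assoc]
    exact (hu.del_pow_mul n).mul_left _
  rw [hv.unique h1, Finset.sum_mul, PDO.act,
    finsum_eq_sum_of_support_subset (s := Finset.range (M + 1))]
  · exact Finset.sum_congr rfl fun n _ => by rw [iterate_matDel_mul_expMat, mul_assoc]
  · intro n hn
    by_contra hc
    simp only [Finset.coe_range, Set.mem_Iio, not_lt] at hc
    refine hn ?_
    simp only
    rw [hM n (by omega), Matrix.map_zero _ (map_zero _), zero_mul]

theorem wave_eq (τ : Charge N → TSeries N k) (s : Charge N) :
    wave τ s = dressSymbol τ s * expMat k s := by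
  ext α β
  rw [expMat, Matrix.mul_diagonal, dressSymbol, Matrix.of_apply, wave, Matrix.of_apply, mul_assoc,
    map_mul, div_mul_eq_mul_div]

end Action

end MultiKP

open MultiKP in
theorem proposition2 {k : Type*} [Field k] [CharZero k] {N : ℕ}
    (τ : Charge N → TSeries N k) (hτ : IsTau τ) (s : Charge N) (hs : τ s ≠ 0)
    (α : Fin N) (j : ℕ+) :
    (∃! V, PDO.IsInverse (dressHat τ s) V) ∧
    (∃! V, PDO.IsInverse (dress τ s) V) ∧
    (opB τ s α j).IsDiffOpOfOrder j ∧
    (opB τ s α j).coeff (j : ℕ) = Matrix.single α α 1 ∧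
    opB τ s α j = (dressHat τ s * unitDel N k α j * (dressHat τ s)⁻¹).posPart ∧
    matTDeriv (α, j) (wave τ s) = (opB τ s α j).act (wave τ s) ∧
    (dressHat τ s).timeDeriv (α, j) * (dressHat τ s)⁻¹ =
      -(dressHat τ s * unitDel N k α j * (dressHat τ s)⁻¹).negPart := by
  have hW := orderLE_dressHat τ s
  have hW0 := coeff_zero_dressHat τ s hs
  obtain ⟨V, hV, hVle, hV0⟩ := PDO.exists_isInverse hW hW0
  have hD : PDO.IsInverse (dress τ s) _ := hV.mul (PDO.isInverse_diagPow (k := k) s)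
  have hB : opB τ s α j = (dressHat τ s * unitDel N k α j * V).posPart := by
    have hinv : (dress τ s)⁻¹ = PDO.diagPow k s.neg * V := hD.inv_eq
    rw [opB, hinv, dress, mul_assoc (dressHat τ s), diagPow_mul_unitDel,
      ← mul_assoc (dressHat τ s), mul_assoc (dressHat τ s * unitDel N k α j),
      ← mul_assoc (PDO.diagPow k s), (PDO.isInverse_diagPow s).1, one_mul]
  rw [hV.inv_eq]
  set G := dressHat τ s * unitDel N k α j * V with hG
  set T := (dressHat τ s).timeDeriv (α, j) * V with hT
  have hU : (unitDel N k α j).OrderLE (j : ℕ) := PDO.orderLE_monomial _ _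
  have hGle : G.OrderLE (j : ℕ) := by simpa using (hW.mul hU).mul hVle
  have hGj : G.coeff (j : ℕ) = Matrix.single α α 1 := by
    have h1 := PDO.coeff_mul_top (hW.mul hU) hVle
    have h2 : (unitDel N k α j).coeff (j : ℕ) = Matrix.single α α 1 := if_pos rfl
    rw [PDO.coeff_mul_top hW hU, hW0, hV0, one_mul, mul_one, add_zero, zero_add, h2] at h1
    exact h1
  have hBj : (opB τ s α j).coeff (j : ℕ) = Matrix.single α α 1 := by
    rw [hB, PDO.coeff_posPart, if_pos (Int.natCast_nonneg (j : ℕ)), hGj]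
  -- the derivative of `Ŵ` has negative order, as the leading coefficient of `Ŵ` is constant
  have hTle : T.OrderLE (-1) := by
    have h1 : ((dressHat τ s).timeDeriv (α, j)).OrderLE (-1) := by
      intro n hn
      change matTDeriv (α, j) ((dressHat τ s).coeff n) = 0
      by_cases h : n = 0
      · rw [h, hW0, matTDeriv_one]
      · rw [hW n (by omega), matTDeriv_zero]
    simpa using h1.mul hVle
  have hX : covPDO (α, j) (dressHat τ s) * V = T + G := add_mul _ _ _
  have hneg := negPart_covPDO_mul_inv hτ hs (α, j) hV
  have hpos : (T + G).posPart = G.posPart := by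
    refine PDO.ext (funext fun n => ?_)
    rw [PDO.coeff_posPart, PDO.coeff_posPart, PDO.coeff_add]
    split_ifs with h
    · rw [hTle n (by omega), zero_add]
    · rfl
  have hXB : covPDO (α, j) (dressHat τ s) = opB τ s α j * dressHat τ s := by
    have h1 := PDO.posPart_add_negPart (covPDO (α, j) (dressHat τ s) * V)
    rw [hneg, add_zero, hX, hpos, ← hB, ← hX] at h1
    rw [h1, mul_assoc, hV.2, mul_one]
  refine ⟨⟨V, hV, fun V' h => h.unique hV⟩, ⟨_, hD, fun V' h => h.unique hD⟩,
    ⟨?_, ?_, ?_⟩, hBj, hB, ?_, ?_⟩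
  · rw [hB]
    exact PDO.isDiffOp_posPart G
  · intro n hn
    rw [hB, PDO.coeff_posPart, hGle n hn, ite_self]
  · rw [hBj]
    intro h
    have h1 := congrFun (congrFun h α) α
    rw [Matrix.single_apply_same] at h1
    exact one_ne_zero h1
  · have h1 := (hasSymbol_dressHat hs).cov (α, j)
    rw [hXB] at h1
    rw [wave_eq, matTDeriv_mul_expMat, (hasSymbol_dressHat hs).act_mul_expMat s _ h1]
    rw [hB]
    exact PDO.isDiffOp_posPart G
  · refine PDO.ext (funext fun n => ?_)
    rw [PDO.coeff_neg, PDO.coeff_negPart]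
    split_ifs with h
    · have h1 := congrArg (fun P => P.coeff n) hneg
      simp only [hX, PDO.coeff_negPart, if_pos h, PDO.coeff_add, PDO.coeff_zero] at h1
      exact eq_neg_of_add_eq_zero_left h1
    · rw [hTle n (by omega), neg_zero]
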